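/- Let $\lambda=(\lambda_1>\lambda_2>\dots>\lambda_\ell>0)$ be a strict partition (possibly empty), write $\ell(\lambda)=\ell$ and $\lambda_i=0$ for $i>\ell$, and let $\mathsf{SD}_\lambda=\{(i,j): 0<i\le j<i+\lambda_i\}$. Consider the ordered alphabet $1'<1<2'<2<\cdots$. A \emph{set-valued shifted tableau} $T$ of shape $\lambda$ assigns to each $(i,j)\in\mathsf{SD}_\lambda$ a nonempty finite subset $T_{ij}$ of this alphabet. It is \emph{semistandard} if: (S1) rows and columns are weakly increasing, i.e. $\max T_{ij}\le\min T_{i,j+1}$ and $\max T_{ij}\le \min T_{i+1,j}$ whenever both positions are in $\mathsf{SD}_\lambda$; (S2) no unprimed number occurs in two positions of the same column; (S3) no primed number occurs in two positions of the same row. Let $\mathrm{SetShYT}_Q(\lambda)$ be the set of semistandard set-valued shifted tableaux of shape $\lambda$, and let $\mathrm{SetShYT}_P(\lambda)$ be the subset of those with no primed number in any diagonal position $(j,j)$. The \emph{weight} of $T$ is $x^T=\prod_{i\ge1}x_i^{m_i}$, where $m_i$ is the total number of times that $i$ or $i'$ appears in $T$. For a set $\mathcal X$ of positions, let $\mathrm{unprime}^{\mathcal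 X}_{\max}(T)$ be obtained from $T$ by removing the prime from the largest element of $T_{ij}$ for each $(i,j)\in\mathcal X$ in the shape for which this largest element is primed. For strict partitions $\mu\subseteq\lambda$ (i.e. $\mu_i\le\lambda_i$ for all $i$) let $\mathrm{SetShYT}_P(\lambda:\mu)$ be the set of $T\in\mathrm{SetShYT}_Q(\lambda)$ such that $\mathrm{unprime}^{\mathcal X}_{\max}(T)\in\mathrm{SetShYT}_P(\lambda)$ for $\mathcal X=\{(i,i):\lambda_i=\mu_i\}$. Let $\mathsf{SD}_{\lambda/\mu}=\mathsf{SD}_\lambda\setminus\mathsf{SD}_\mu$, $|\lambda/\mu|=|\mathsf{SD}_{\lambda/\mu}|$, and let $\mathsf{cols}(\lambda/\mu)$ be the number of distinct columns $j$ occupied by the positions $(i,j)\in\mathsf{SD}_{\lambda/\mu}$. Let $\Lambda^{\pm}(\mu)$ be the set of strict partitions $\lambda\supseteq\mu$ with $\ell(\lambda)=\ell(\mu)$ such that $\mathsf{SD}_{\lambda/\mu}$ has at most one position in each row and $(-1)^{\mathsf{cols}(\lambda/\mu)+|\lambda/\mu|}=\pm1$. \textbf{Corollary.} For each strict partition $\mu$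 there is a weight-preserving bijection $$\mathrm{SetShYT}_Q(\mu)\ \sqcup\bigsqcup_{\lambda\in\Lambda^-(\mu)}\mathrm{SetShYT}_P(\lambda:\mu)\ \longrightarrow\ \bigsqcup_{\lambda\in\Lambda^+(\mu)}\mathrm{SetShYT}_P(\lambda:\mu),$$ that is, a bijection under which corresponding tableaux have the same weight $x^T$. -/

import Mathlib

namespace ShiftedTableaux

/-- A strict partition `λ = (λ₁ > λ₂ > ⋯ > λ_ℓ > 0)`, possibly empty. -/
@[ext]
structure StrictPartition where
  parts : List ℕ
  strict : parts.Pairwise (· > ·)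
  pos : ∀ p ∈ parts, 0 < p

namespace StrictPartition

/-- The number of parts `ℓ(λ)`. -/
def length (la : StrictPartition) : ℕ := la.parts.length

/-- The part `λ_i` for `i ≥ 1`, which is `0` for `i > ℓ(λ)`. (The value at `i = 0` has no meaning
and is never used.) -/
def part (la : StrictPartition) (i : ℕ) : ℕ := la.parts.getD (i - 1) 0

/-- The shifted diagram `SD_λ = {(i, j) : 0 < i ≤ j < i + λ_i}`; see `mem_SD`. -/
def SD (la : StrictPartition) : Finset (ℕ × ℕ) :=
  (Finset.Icc 1 la.length).biUnion fun i =>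
    (Finset.Ico i (i + la.part i)).image fun j => (i, j)

theorem mem_SD (la : StrictPartition) (i j : ℕ) :
    (i, j) ∈ la.SD ↔ 0 < i ∧ i ≤ j ∧ j < i + la.part i := by
  simp only [SD, Finset.mem_biUnion, Finset.mem_Icc, Finset.mem_image, Finset.mem_Ico,
    Prod.mk.injEq]
  constructor
  · rintro ⟨a, ⟨h1, _⟩, b, ⟨h3, h4⟩, rfl, rfl⟩
    exact ⟨h1, h3, h4⟩
  · rintro ⟨h1, h2, h3⟩
    refine ⟨i, ⟨h1, ?_⟩, j, ⟨h2, h3⟩, rfl, rfl⟩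
    by_contra h
    have h0 : la.part i = 0 := by
      unfold part
      unfold length at h
      exact List.getD_eq_default _ _ (by omega)
    omega

/-- Containment `μ ⊆ λ`: `μ_i ≤ λ_i` for all `i ≥ 1`. -/
def Contained (mu la : StrictPartition) : Prop := ∀ i, 1 ≤ i → mu.part i ≤ la.part i

/-- The skew shifted diagram `SD_{λ/μ} = SD_λ \ SD_μ`. -/
def skewSD (la mu : StrictPartition) : Finset (ℕ × ℕ) := la.SD \ mu.SD

/-- The size `|λ/μ|`. -/
def skewSize (la mu : StrictPartition) : ℕ := (skewSD la mu).card

/-- The number `cols(λ/μ)` of distinct columns occupied by the positions in `SD_{λ/μ}`. -/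
def cols (la mu : StrictPartition) : ℕ := ((skewSD la mu).image Prod.snd).card

/-- `SD_{λ/μ}` is a vertical strip: it has at most one position in each row. -/
def IsVerticalStrip (la mu : StrictPartition) : Prop :=
  ∀ b ∈ skewSD la mu, ∀ c ∈ skewSD la mu, b.1 = c.1 → b = c

/-- `Λ(μ)`: the strict partitions `λ ⊇ μ` with `ℓ(λ) = ℓ(μ)` such that `SD_{λ/μ}` is a vertical
strip. -/
def Lam (mu : StrictPartition) : Set StrictPartition :=
  {la | Contained mu la ∧ la.length = mu.length ∧ IsVerticalStrip la mu}

/-- `Λ⁺(μ)`: those `λ ∈ Λ(μ)` with `(-1)^(cols(λ/μ) + |λ/μ|) = 1`. -/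
def LamPlus (mu : StrictPartition) : Set StrictPartition :=
  {la | la ∈ Lam mu ∧ (-1 : ℤ) ^ (cols la mu + skewSize la mu) = 1}

/-- `Λ⁻(μ)`: those `λ ∈ Λ(μ)` with `(-1)^(cols(λ/μ) + |λ/μ|) = -1`. -/
def LamMinus (mu : StrictPartition) : Set StrictPartition :=
  {la | la ∈ Lam mu ∧ (-1 : ℤ) ^ (cols la mu + skewSize la mu) = -1}

end StrictPartition

/-- The ordered alphabet `1' < 1 < 2' < 2 < ⋯` of positive half-integers (`i' = i - 1/2`):
`(i, false)` is the primed number `i'`, `(i, true)` is the unprimed number `i`, and the order is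
lexicographic with `false < true`. -/
abbrev Entry : Type := ℕ+ ×ₗ Bool

namespace Entry

/-- The number `i` underlying `i` or `i'`. -/
def index (a : Entry) : ℕ+ := (ofLex a).1

/-- `a` is a primed number. -/
def IsPrimed (a : Entry) : Prop := (ofLex a).2 = false

/-- Remove the prime: `i' ↦ i` and `i ↦ i`. -/
def unprime (a : Entry) : Entry := toLex (a.index, true)

end Entry

/-- A set-valued shifted tableau of shape `λ`: a filling of `SD_λ` by nonempty finite sets of
entries, extended by the empty set to the positions outside `SD_λ`. -/
@[ext]
structure SetTableau (la : StrictPartition) where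
  entry : ℕ × ℕ → Finset Entry
  nonempty_iff : ∀ b, (entry b).Nonempty ↔ b ∈ la.SD

/-- Remove the prime from the largest element of a finite set of entries if that element is primed
(if it is not, the set does not change). -/
def unprimeMaxSet (S : Finset Entry) : Finset Entry :=
  if h : S.Nonempty then insert (S.max' h).unprime (S.erase (S.max' h)) else ∅

theorem unprimeMaxSet_nonempty (S : Finset Entry) : (unprimeMaxSet S).Nonempty ↔ S.Nonempty := by
  unfold unprimeMaxSet
  split_ifs with h <;> simp [h]

namespace SetTableau

variable {la : StrictPartition}

/-- (S1) The entries in each row and column are weakly increasing, where a sequence of sets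
`S₁, S₂, …` is weakly increasing if `max S_k ≤ min S_{k+1}` for all `k`;
(S2) no unprimed number occurs more than once in a column;
(S3) no primed number occurs more than once in a row. -/
structure IsSemistandard (T : SetTableau la) : Prop where
  row_le : ∀ i j, ∀ a ∈ T.entry (i, j), ∀ b ∈ T.entry (i, j + 1), a ≤ b
  col_le : ∀ i j, ∀ a ∈ T.entry (i, j), ∀ b ∈ T.entry (i + 1, j), a ≤ b
  col_unprimed : ∀ j i₁ i₂ a, ¬ a.IsPrimed →
    a ∈ T.entry (i₁, j) → a ∈ T.entry (i₂, j) → i₁ = i₂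
  row_primed : ∀ i j₁ j₂ a, a.IsPrimed →
    a ∈ T.entry (i, j₁) → a ∈ T.entry (i, j₂) → j₁ = j₂

/-- The weight `x^T = ∏ x_i ^ m_i`, where `m_i` is the number of times that `i` or `i'` appears
in `T`, as a monomial in the variables `x₁, x₂, …`. -/
noncomputable def weight (T : SetTableau la) : MvPolynomial ℕ+ ℤ :=
  ∏ b ∈ la.SD, ∏ a ∈ T.entry b, MvPolynomial.X a.index

open Classical in
/-- `unprime_max^𝒳(T)`: remove the prime from the largest element of `T_{ij}` for each
`(i, j) ∈ 𝒳`, whenever this element is primed. -/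
noncomputable def unprimeMax (X : Set (ℕ × ℕ)) (T : SetTableau la) : SetTableau la where
  entry b := if b ∈ X then unprimeMaxSet (T.entry b) else T.entry b
  nonempty_iff b := by
    split_ifs
    · rw [unprimeMaxSet_nonempty, T.nonempty_iff]
    · exact T.nonempty_iff b

end SetTableau

/-- `SetShYT_Q(λ)`: the semistandard set-valued shifted tableaux of shape `λ`. -/
def SetShYTQ (la : StrictPartition) : Set (SetTableau la) := {T | T.IsSemistandard}

/-- `SetShYT_P(λ)`: the elements of `SetShYT_Q(λ)` that also satisfy (S4) no primed number occurs
in a diagonal position. -/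
def SetShYTP (la : StrictPartition) : Set (SetTableau la) :=
  {T | T ∈ SetShYTQ la ∧ ∀ j, ∀ a ∈ T.entry (j, j), ¬ a.IsPrimed}

/-- `SetShYT_P(λ : μ)`: the `T ∈ SetShYT_Q(λ)` with `unprime_max^𝒳(T) ∈ SetShYT_P(λ)` for
`𝒳 = {(i, i) : λ_i = μ_i}`. -/
def SetShYTPRel (la mu : StrictPartition) : Set (SetTableau la) :=
  {T | T ∈ SetShYTQ la ∧
    T.unprimeMax {b | ∃ i, 1 ≤ i ∧ la.part i = mu.part i ∧ b = (i, i)} ∈ SetShYTP la}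

end ShiftedTableaux

/-!
The theorem is a bijective form of the expansion of the K-theoretic Schur `Q`-function of `μ` in
K-theoretic Schur `P`-functions, `GQ_μ = ∑_{λ ∈ Λ(μ)} ± 2^{#{i : λ_i = μ_i}} GP_λ`. There are
finitely many tableaux of each weight, so it suffices to compare numbers of tableaux weight by
weight (`exists_equiv_of_card_fiber_eq`). Making the largest entries of chosen diagonal boxes primed
shows that `SetShYT_P(λ : μ)` is `SetShYT_P(λ)` times the set of subsets of `{i : λ_i = μ_i}`
(`relEquiv`), which explains the power of two.

The expansion itself is proved one variable at a time. Strict partitions are encoded as bit lists,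
and tableaux are grown by allowing one letter `a` on one diagonal `c` after the other. If `a` is
maximal and has been allowed only on later diagonals (`a` primed) or earlier ones (`a` unprimed), a
box on diagonal `c` that contains `a` must be a corner of the shape, and erasing `a` from it leaves
either the shape or the shape without this corner. So, on generating functions regarded as
functions of the shape, the new permission acts as `1 + x π_c` with `π_c` a generator of a
0-Hecke algebra (`genFun_adjoin`, `boxOp`). One variable `x` thus acts on `Q`-type functions by
`D (1 + x π_0)² U` and on `P`-type functions by `D (1 + x π_0) U`, where
`U = (1 + x π_1)(1 + x π_2)⋯` and `D = ⋯(1 + x π_2)(1 + x π_1)` (`genFun_allow_succ`).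

The coefficients of the expansion form a one-row transfer matrix `A` (`expand`) whose horizontal
edges carry one bit, namely whether a box is added on the corresponding diagonal. The identity
`D (1 + x π_0)² U A = A D (1 + x π_0) U` is proved by a train argument: change the weights of `A` at
a single site; then `1 + x π_{j+1}` commutes past `A` at the price of moving this defect by one site
(`expandAt_boxOp_succ`, `boxOp_succ_expandAt`), and at the boundary the defect for `U` is turned
into the defect for `D` while one factor `1 + x π_0` is absorbed
(`boxOp_zero_boxOp_zero_expandAt`). Starting with the defect beyond the largest part, where it is
invisible, gives the identity (`transferQ_expand`). Finally the entries of `A` are identified with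
the signs and powers of two of the theorem (`coef_eq`, `ofBits_mem_Lam_iff`).
-/

namespace ShiftedTableaux

/-! ### Removing a corner from a bit list -/

/-- A bit list `l` encodes the strict partition with part `p ≥ 1` present iff the bit at index
`p - 1` is `true`. `removeBox c l` removes the corner box on the diagonal `j - i = c`, that is,
replaces the part `c + 1` by `c` (or deletes it if `c = 0`). It is `none` if there is no such
corner: `c + 1` is not a part, or `c` is one. -/
def removeBox : ℕ → List Bool → Option (List Bool)
  | 0, true :: l => some (false :: l)
  | 0, _ => none
  | 1, false :: true :: l => some (true :: false :: l)
  | 1, _ => none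
  | _ + 2, [] => none
  | c + 2, a :: l => (removeBox (c + 1) l).map (List.cons a)

theorem length_of_removeBox {c : ℕ} {l r : List Bool} (h : removeBox c l = some r) :
    r.length = l.length := by
  induction c using Nat.strong_induction_on generalizing l r with
  | _ c ih =>
    rcases c with _ | _ | c
    · rcases l with _ | ⟨_ | _, l⟩ <;> simp [removeBox] at h
      subst h; rfl
    · rcases l with _ | ⟨_ | _, _ | ⟨_ | _, l⟩⟩ <;> simp [removeBox] at h
      subst h; rfl
    · rcases l with _ | ⟨a, l⟩
      · simp [removeBox] at h
      · rw [removeBox, Option.map_eq_some_iff] at h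
        obtain ⟨r, hr, rfl⟩ := h
        simpa using ih (c + 1) (by omega) hr

theorem getLast?_of_removeBox {c : ℕ} {l r : List Bool} (h : removeBox c l = some r)
    (hl : l.getLast? = some false) : r.getLast? = some false := by
  induction c using Nat.strong_induction_on generalizing l r with
  | _ c ih =>
    rcases c with _ | _ | c
    · rcases l with _ | ⟨_ | _, _ | ⟨b, l⟩⟩ <;> simp [removeBox] at h
      · simp at hl
      · subst h; simpa using hl
    · rcases l with _ | ⟨_ | _, _ | ⟨_ | _, _ | ⟨b, l⟩⟩⟩ <;> simp [removeBox] at h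
      · simp at hl
      · subst h; simpa using hl
    · rcases l with _ | ⟨a, _ | ⟨b, l⟩⟩
      · simp [removeBox] at h
      · cases c <;> simp [removeBox] at h
      · rw [removeBox, Option.map_eq_some_iff] at h
        obtain ⟨r, hr, rfl⟩ := h
        have := ih (c + 1) (by omega) hr (by simpa using hl)
        rw [List.getLast?_cons, this]; rfl

/-! ### The transfer matrix and its commutation with the box operators -/

section Transfer

variable {K : Type*} [CommRing K]

/-- The operator `1 + x π_c` on functions of bit lists, where `(π_c f)(l) = f(l) + f(l')` if `l'` is
`l` with its corner on diagonal `c` removed, and `(π_c f)(l) = 0` if there is no such corner; see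
`boxOp_eq_removeBox`. Spelled out recursively so that it can be computed site by site. -/
def boxOp (x : K) : ℕ → (List Bool → K) → List Bool → K
  | 0, f, true :: l => (1 + x) * f (true :: l) + x * f (false :: l)
  | 0, f, l => f l
  | 1, f, false :: true :: l =>
      (1 + x) * f (false :: true :: l) + x * f (true :: false :: l)
  | 1, f, l => f l
  | _ + 2, f, [] => f []
  | c + 2, f, a :: l => boxOp x (c + 1) (fun t => f (a :: t)) l

/-- One site of the transfer matrix. The bit argument is the state of the edge below the site, and
`F` is the rest of the matrix, which receives the state of the edge above. An edge in state `true`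
carries one part down to the next smaller position. So with `m` the bit of the given list and `a`
that of the argument of `f`, the weights are `s` if a part stays (`m = a = true`, both edges
`false`), `h` if a part only arrives from above, `1` if a part only leaves or the site is empty,
and `t` if one part leaves and another arrives. -/
def siteOp (s h t : K) (F : Bool → (List Bool → K) → List Bool → K) :
    Bool → (List Bool → K) → List Bool → K
  | false, f, [] => f []
  | true, _, [] => 0
  | false, f, false :: l => F false (fun r => f (false :: r)) l
  | false, f, true :: l =>
      s * F false (fun r => f (true :: r)) l + h * F true (fun r => f (false :: r)) l
  | true, f, false :: l => F false (fun r => f (true :: r)) l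
  | true, f, true :: l => t * F true (fun r => f (true :: r)) l

/-- The transfer matrix with site weights `s = 2`, `h = 1`, `t = -1` and no part arriving at the top
end: `expand b f l = ∑ r, coef b l r * f r`, see `expand_eq_sum`. For `b = false` it
turns `P`-type into `Q`-type generating functions. -/
def expand : Bool → (List Bool → K) → List Bool → K
  | false, f, [] => f []
  | true, _, [] => 0
  | false, f, false :: l => expand false (fun r => f (false :: r)) l
  | false, f, true :: l =>
      2 * expand false (fun r => f (true :: r)) l + expand true (fun r => f (false :: r)) l
  | true, f, false :: l => expand false (fun r => f (true :: r)) l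
  | true, f, true :: l => - expand true (fun r => f (true :: r)) l

/-- The transfer matrix `expand` with a defect: the weights at index `j` are `s`, `h`, `-1`. -/
def expandAt (s h : K) : ℕ → Bool → (List Bool → K) → List Bool → K
  | 0 => siteOp s h (-1) expand
  | j + 1 => siteOp 2 1 (-1) (expandAt s h j)

theorem expand_eq (b : Bool) (f : List Bool → K) (l : List Bool) :
    expand b f l = siteOp 2 1 (-1) expand b f l := by
  cases b <;> rcases l with _ | ⟨_ | _, l⟩ <;> simp [expand, siteOp]

theorem expand_linear (p q : K) (b : Bool) (f g : List Bool → K) (l : List Bool) :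
    expand b (fun r => p * f r + q * g r) l = p * expand b f l + q * expand b g l := by
  induction l generalizing b f g with
  | nil => cases b <;> simp [expand]
  | cons a l ih =>
    cases b <;> cases a <;> simp only [expand, ih] <;> ring

theorem expand_congr {f g : List Bool → K} (b : Bool) (n : ℕ)
    (h : ∀ r, r.length = n → f r = g r) (l : List Bool) (hl : l.length = n) :
    expand b f l = expand b g l := by
  induction l generalizing b f g n with
  | nil => cases b <;> simp [expand, h [] hl]
  | cons a l ih =>
    have e : ∀ b d, expand b (fun r => f (d :: r)) l = expand b (fun r => g (d :: r)) l :=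
      fun b d => ih b l.length (fun r hr => h _ (by rw [← hl]; simpa using hr)) rfl
    cases b <;> cases a <;> simp only [expand, e]

theorem boxOp_linear (x p q : K) (c : ℕ) (f g : List Bool → K) (l : List Bool) :
    boxOp x c (fun r => p * f r + q * g r) l = p * boxOp x c f l + q * boxOp x c g l := by
  induction c using Nat.strong_induction_on generalizing f g l with
  | _ c ih =>
    rcases c with _ | _ | c
    · rcases l with _ | ⟨_ | _, l⟩ <;> simp only [boxOp]
      ring
    · rcases l with _ | ⟨_ | _, _ | ⟨_ | _, l⟩⟩ <;> simp only [boxOp]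
      ring
    · rcases l with _ | ⟨a, l⟩
      · simp only [boxOp]
      · simp only [boxOp]; exact ih (c + 1) (by omega) _ _ l

theorem boxOp_smul (x p : K) (c : ℕ) (f : List Bool → K) (l : List Bool) :
    boxOp x c (fun r => p * f r) l = p * boxOp x c f l := by
  simpa using boxOp_linear x p 0 c f f l

/-- Moving `1 + x π_{j+1}` past the transfer matrix moves a defect from index `j` to `j + 1`; this
is a Yang–Baxter-type identity between the two sites that `π_{j+1}` touches. The weights of the
defect are forced by it. -/
theorem expandAt_boxOp_succ {F : Type*} [Field F] (x : F) (hx : 1 + x ≠ 0) (j : ℕ)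
    (b : Bool) (f : List Bool → F)
    (l : List Bool) (hl : j + 2 ≤ l.length) :
    expandAt ((2 + x) / (1 + x)) (1 / (1 + x)) j b (boxOp x (j + 1) f) l
      = boxOp x (j + 1) (expandAt ((2 + x) / (1 + x)) (1 / (1 + x)) (j + 1) b f) l := by
  induction j generalizing b f l with
  | zero =>
    rcases l with _ | ⟨m, _ | ⟨n, l⟩⟩
    · simp at hl
    · simp at hl
    · cases b <;> cases m <;> cases n <;>
        simp only [expandAt, siteOp, boxOp, expand, expand_linear] <;> field_simp <;> ring
  | succ j ih =>
    rcases l with _ | ⟨m, l⟩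
    · simp at hl
    · have hl' : j + 2 ≤ l.length := by simpa using hl
      have e : ∀ (b a : Bool), expandAt ((2 + x) / (1 + x)) (1 / (1 + x)) j b
          (fun r => boxOp x (j + 1 + 1) f (a :: r)) l = boxOp x (j + 1)
            (expandAt ((2 + x) / (1 + x)) (1 / (1 + x)) (j + 1) b fun r => f (a :: r)) l :=
        fun b a => ih b (fun r => f (a :: r)) l hl'
      cases b <;> cases m <;> rw [boxOp, expandAt, siteOp] <;>
        simp only [e, expandAt.eq_2 _ _ (j + 1), siteOp, boxOp_linear, boxOp_smul]

/-- The counterpart of `expandAt_boxOp_succ` with the order of the two operators reversed; it needs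
a defect with other weights. -/
theorem boxOp_succ_expandAt (x : K) (j : ℕ) (b : Bool) (f : List Bool → K)
    (l : List Bool) (hl : j + 2 ≤ l.length) :
    boxOp x (j + 1) (expandAt (2 + x) (1 + x) j b f) l
      = expandAt (2 + x) (1 + x) (j + 1) b (boxOp x (j + 1) f) l := by
  induction j generalizing b f l with
  | zero =>
    rcases l with _ | ⟨m, _ | ⟨n, l⟩⟩
    · simp at hl
    · simp at hl
    · cases b <;> cases m <;> cases n <;>
        simp only [expandAt, siteOp, boxOp, expand, expand_linear] <;> ring
  | succ j ih =>
    rcases l with _ | ⟨m, l⟩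
    · simp at hl
    · have hl' : j + 2 ≤ l.length := by simpa using hl
      have e : ∀ (b a : Bool), expandAt (2 + x) (1 + x) (j + 1) b
          (fun r => boxOp x (j + 1 + 1) f (a :: r)) l = boxOp x (j + 1)
            (expandAt (2 + x) (1 + x) j b fun r => f (a :: r)) l :=
        fun b a => (ih b (fun r => f (a :: r)) l hl').symm
      cases b <;> cases m <;> rw [boxOp, expandAt.eq_2 _ _ (j + 1), siteOp] <;>
        simp only [e, expandAt.eq_2 _ _ j, siteOp, boxOp_linear, boxOp_smul]

/-- The boundary relation: at the lowest site the defect of `expandAt_boxOp_succ` becomes that of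
`boxOp_succ_expandAt`, and one of two factors `1 + x π_0` is absorbed. -/
theorem boxOp_zero_boxOp_zero_expandAt {F : Type*} [Field F] (x : F) (hx : 1 + x ≠ 0)
    (f : List Bool → F)
    (l : List Bool) :
    boxOp x 0 (boxOp x 0 (expandAt ((2 + x) / (1 + x)) (1 / (1 + x)) 0 false f)) l
      = expandAt (2 + x) (1 + x) 0 false (boxOp x 0 f) l := by
  rcases l with _ | ⟨_ | _, l⟩ <;> simp only [expandAt, siteOp, boxOp, expand_linear]
  field_simp
  ring

/-- `boxOpsUp x c n f = (1 + x π_{c+n-1}) ⋯ (1 + x π_{c+1}) (1 + x π_c) f`. -/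
def boxOpsUp (x : K) (c : ℕ) : ℕ → (List Bool → K) → List Bool → K
  | 0, f => f
  | n + 1, f => boxOp x (c + n) (boxOpsUp x c n f)

/-- `boxOpsDown x c n f = (1 + x π_c) (1 + x π_{c+1}) ⋯ (1 + x π_{c+n-1}) f`. -/
def boxOpsDown (x : K) : ℕ → ℕ → (List Bool → K) → List Bool → K
  | _, 0, f => f
  | c, n + 1, f => boxOp x c (boxOpsDown x (c + 1) n f)

theorem boxOp_eq_removeBox (x : K) (c : ℕ) (f : List Bool → K) (l : List Bool) :
    boxOp x c f l = match removeBox c l with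
      | none => f l
      | some r => (1 + x) * f l + x * f r := by
  induction c using Nat.strong_induction_on generalizing f l with
  | _ c ih =>
    rcases c with _ | _ | c
    · rcases l with _ | ⟨_ | _, l⟩ <;> simp only [boxOp, removeBox]
    · rcases l with _ | ⟨_ | _, _ | ⟨_ | _, l⟩⟩ <;> simp only [boxOp, removeBox]
    · rcases l with _ | ⟨a, l⟩
      · simp only [boxOp, removeBox]
      · simp only [boxOp, removeBox, ih (c + 1) (by omega)]
        cases removeBox (c + 1) l <;> rfl

/-- `boxOp` at `l` evaluates `f` only at `l` and at smaller shapes, so that it respects equality on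
any class `S` that is closed under the removal of corners. -/
theorem boxOp_congr {x : K} {c : ℕ} {S : List Bool → Prop} {f g : List Bool → K}
    (hS : ∀ l r, S l → removeBox c l = some r → S r) (h : ∀ l, S l → f l = g l) (l : List Bool)
    (hl : S l) : boxOp x c f l = boxOp x c g l := by
  rw [boxOp_eq_removeBox, boxOp_eq_removeBox]
  rcases e : removeBox c l with _ | r
  · exact h l hl
  · simp only [h l hl, h r (hS l r hl e)]

theorem boxOpsUp_congr {x : K} {c n : ℕ} {S : List Bool → Prop} {f g : List Bool → K}
    (hS : ∀ c l r, S l → removeBox c l = some r → S r) (h : ∀ l, S l → f l = g l) (l : List Bool)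
    (hl : S l) : boxOpsUp x c n f l = boxOpsUp x c n g l := by
  induction n generalizing l with
  | zero => exact h l hl
  | succ n ih => exact boxOp_congr (hS _) ih l hl

theorem boxOpsDown_congr {x : K} {c n : ℕ} {S : List Bool → Prop} {f g : List Bool → K}
    (hS : ∀ c l r, S l → removeBox c l = some r → S r) (h : ∀ l, S l → f l = g l) (l : List Bool)
    (hl : S l) : boxOpsDown x c n f l = boxOpsDown x c n g l := by
  induction n generalizing c l with
  | zero => exact h l hl
  | succ n ih => exact boxOp_congr (hS _) (fun r hr => ih r hr) l hl

theorem boxOpsDown_expandAt {F : Type*} [Field F] (x : F) (hx : 1 + x ≠ 0) (j n : ℕ)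
    (f : List Bool → F) (l : List Bool)
    (hl : l.length = j + n + 1) :
    boxOpsDown x (j + 1) n (expandAt ((2 + x) / (1 + x)) (1 / (1 + x)) (j + n) false f) l
      = expandAt ((2 + x) / (1 + x)) (1 / (1 + x)) j false (boxOpsDown x (j + 1) n f) l := by
  induction n generalizing j l with
  | zero => rfl
  | succ n ih =>
    rw [boxOpsDown, boxOpsDown, expandAt_boxOp_succ x hx j _ _ _ (by omega)]
    refine boxOp_congr (S := fun r => r.length = j + (n + 1) + 1)
      (fun l r h e => (length_of_removeBox e).trans h) (fun r hr => ?_) l hl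
    have := ih (j + 1) r (by omega)
    rwa [show j + 1 + n = j + (n + 1) by ring] at this

theorem boxOpsUp_expandAt (x : K) (n : ℕ) (f : List Bool → K) (l : List Bool)
    (hl : n + 1 ≤ l.length) :
    boxOpsUp x 1 n (expandAt (2 + x) (1 + x) 0 false f) l
      = expandAt (2 + x) (1 + x) n false (boxOpsUp x 1 n f) l := by
  induction n generalizing l with
  | zero => rfl
  | succ n ih =>
    rw [boxOpsUp, boxOpsUp, add_comm 1 n, ← boxOp_succ_expandAt x n _ _ _ (by omega)]
    refine boxOp_congr (S := fun r => r.length = l.length)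
      (fun l r h e => (length_of_removeBox e).trans h) (fun r hr => ih r (by omega)) l rfl

/-- A defect at the last site is invisible if the last bit of the list is `false`, because the
weights that it changes occur only at sites occupied in the list. -/
theorem expandAt_of_getLast? (s h : K) (b : Bool) (f : List Bool → K) (j : ℕ) (l : List Bool)
    (hj : l.length = j + 1) (hl : l.getLast? = some false) :
    expandAt s h j b f l = expand b f l := by
  induction j generalizing b f l with
  | zero =>
    obtain ⟨a, rfl⟩ := List.length_eq_one_iff.1 hj
    obtain rfl : a = false := by simpa using hl
    cases b <;> simp [expandAt, siteOp, expand]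
  | succ j ih =>
    rcases l with _ | ⟨a, _ | ⟨c, l⟩⟩
    · simp at hj
    · simp at hj
    · rw [List.getLast?_cons_cons] at hl
      have e := fun b f => ih b f (c :: l) (by simpa using hj) hl
      rw [expand_eq]
      cases b <;> cases a <;> simp only [expandAt, siteOp, e]

/-- The action of one variable on `Q`-type generating functions of bit lists of length `N + 1`: the
primed letter is added on the diagonals `N, …, 0`, and then the unprimed letter on `0, …, N`. -/
def transferQ (x : K) (N : ℕ) (f : List Bool → K) : List Bool → K :=
  boxOpsUp x 0 (N + 1) (boxOpsDown x 0 (N + 1) f)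

/-- The action of one variable on `P`-type generating functions of bit lists of length `N + 1`: as
`transferQ`, but the primed letter is not allowed on the main diagonal. -/
def transferP (x : K) (N : ℕ) (f : List Bool → K) : List Bool → K :=
  boxOpsUp x 0 (N + 1) (boxOpsDown x 1 N f)

theorem boxOpsUp_succ_eq (x : K) (c n : ℕ) (f : List Bool → K) :
    boxOpsUp x c (n + 1) f = boxOpsUp x (c + 1) n (boxOp x c f) := by
  induction n with
  | zero => rfl
  | succ n ih => rw [boxOpsUp, ih, boxOpsUp, show c + (n + 1) = c + 1 + n by ring]

/-- The transfer matrix intertwines the actions of one variable on `P`-type and on `Q`-type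
functions. The last bit has to be `false` because `expand` evaluates `f` also at shapes whose
largest part is greater by one. -/
theorem transferQ_expand {F : Type*} [Field F] (x : F) (hx : 1 + x ≠ 0) (N : ℕ)
    (f : List Bool → F) (l : List Bool)
    (hN : l.length = N + 1) (hl : l.getLast? = some false) :
    transferQ x N (expand false f) l = expand false (transferP x N f) l := by
  -- put the defect at the last site, where it is invisible
  have h1 : transferQ x N (expand false f) l = transferQ x N
      (expandAt ((2 + x) / (1 + x)) (1 / (1 + x)) N false f) l := by
    refine boxOpsUp_congr (S := fun r => r.length = N + 1 ∧ r.getLast? = some false)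
      (fun c l r h e => ⟨(length_of_removeBox e).trans h.1, getLast?_of_removeBox e h.2⟩)
      (fun r hr => ?_) l ⟨hN, hl⟩
    refine boxOpsDown_congr (S := fun r => r.length = N + 1 ∧ r.getLast? = some false)
      (fun c l r h e => ⟨(length_of_removeBox e).trans h.1, getLast?_of_removeBox e h.2⟩)
      (fun r hr => ?_) r hr
    exact (expandAt_of_getLast? _ _ _ _ _ _ hr.1 hr.2).symm
  rw [h1, transferQ, transferP, boxOpsDown, boxOpsUp_succ_eq, boxOpsUp_succ_eq,
    ← expandAt_of_getLast? (2 + x) (1 + x) _ _ N l hN hl, ← boxOpsUp_expandAt x N _ l hN.ge]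
  have hS : ∀ c l r, List.length l = N + 1 → removeBox c l = some r → r.length = N + 1 :=
    fun c l r h e => (length_of_removeBox e).trans h
  refine boxOpsUp_congr hS (fun r hr => ?_) l hN
  rw [← boxOp_zero_boxOp_zero_expandAt x hx]
  refine boxOp_congr (hS _) (fun r hr => boxOp_congr (hS _) (fun r hr => ?_) r hr) r hr
  have := boxOpsDown_expandAt x hx 0 N f r (by omega)
  simp only [zero_add] at this ⊢
  exact this

end Transfer

/-! ### Bit lists as strict partitions -/

section Shapes

/-- The parts of the strict partition of a bit list, in decreasing order. Each further bit at the
head increases all parts by one and decides whether `1` is a part. -/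
def partsOf : List Bool → List ℕ
  | [] => []
  | a :: l => (partsOf l).map (· + 1) ++ (if a then [1] else [])

/-- The number of boxes on the diagonal `j - i = c` is the number of parts greater than `c`, which
is the number of `true` bits from index `c` on. -/
theorem lt_getD_partsOf (l : List Bool) (c i : ℕ) :
    c < (partsOf l).getD i 0 ↔ i < (l.drop c).count true := by
  have hlen : ∀ l : List Bool, (partsOf l).length = l.count true := by
    intro l
    induction l with
    | nil => rfl
    | cons a l ih => cases a <;> simp [partsOf, ih]
  induction l generalizing c with
  | nil => simp [partsOf]
  | cons a l ih =>
    rcases lt_trichotomy i (partsOf l).length with h | h | h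
    · have e : (partsOf (a :: l)).getD i 0 = (partsOf l).getD i 0 + 1 := by
        simp [partsOf, List.getD_eq_getElem?_getD, List.getElem?_append, h]
      rw [e]
      rcases c with _ | c
      · have := hlen l
        cases a <;> simp <;> omega
      · simpa using ih c
    · rcases c with _ | c
      · cases a <;> simp [partsOf, h, hlen]
      · have := ih c
        rw [h] at this ⊢
        have h0 : (partsOf l).getD (partsOf l).length 0 = 0 := by simp
        rw [h0] at this
        cases a <;> simp [partsOf] <;> simpa using this
    · have e : (partsOf (a :: l)).getD i 0 = 0 := by
        apply List.getD_eq_default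
        cases a <;> simp [partsOf] <;> omega
      rw [e]
      have h1 : ((a :: l).drop c).count true ≤ (a :: l).count true :=
        (List.drop_sublist c _).count_le true
      have h2 := hlen l
      have h3 : (a :: l).count true ≤ l.count true + 1 := by cases a <;> simp
      constructor
      · omega
      · intro; omega

/-- The strict partition encoded by a bit list. -/
def ofBits (l : List Bool) : StrictPartition where
  parts := partsOf l
  strict := by
    induction l with
    | nil => simp [partsOf]
    | cons a l ih =>
      rw [partsOf, List.pairwise_append]
      refine ⟨?_, by cases a <;> simp, ?_⟩
      · rw [List.pairwise_map]
        exact ih.imp (by simp)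
      · have : ∀ p ∈ partsOf l, 0 < p := by
          cases l with
          | nil => simp [partsOf]
          | cons b l => cases b <;> simp +contextual [partsOf, or_imp]
        cases a
        · simp
        · simpa using this
  pos := by
    cases l with
    | nil => simp [partsOf]
    | cons a l => cases a <;> simp +contextual [partsOf, or_imp]

theorem mem_SD_ofBits (l : List Bool) (i j : ℕ) :
    (i, j) ∈ (ofBits l).SD ↔ 0 < i ∧ i ≤ j ∧ i ≤ (l.drop (j - i)).count true := by
  rw [StrictPartition.mem_SD, StrictPartition.part]
  have := lt_getD_partsOf l (j - i) (i - 1)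
  change _ ∧ _ ∧ j < i + (partsOf l).getD (i - 1) 0 ↔ _
  omega

theorem count_drop_succ_le (l : List Bool) (c : ℕ) :
    (l.drop c).count true ≤ (l.drop (c + 1)).count true + 1 := by
  rcases Nat.lt_or_ge c l.length with h | h
  · rw [List.drop_eq_getElem_cons h]
    cases l[c] <;> simp
  · simp [List.drop_eq_nil_of_le h]

theorem count_drop_succ_ge (l : List Bool) (c : ℕ) :
    (l.drop (c + 1)).count true ≤ (l.drop c).count true := by
  rw [← List.drop_drop]
  exact (List.drop_sublist 1 _).count_le true

theorem count_drop_le_add (l : List Bool) (c k : ℕ) :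
    (l.drop c).count true ≤ (l.drop (c + k)).count true + k := by
  induction k with
  | zero => simp
  | succ k ih =>
    have := count_drop_succ_le l (c + k)
    rw [show c + (k + 1) = c + k + 1 from rfl]
    omega

theorem count_drop_anti (l : List Bool) {c d : ℕ} (h : c ≤ d) :
    (l.drop d).count true ≤ (l.drop c).count true := by
  obtain ⟨k, rfl⟩ := Nat.exists_eq_add_of_le h
  rw [← List.drop_drop]
  exact (List.drop_sublist k _).count_le true

theorem count_drop_of_removeBox {c : ℕ} {l r : List Bool} (h : removeBox c l = some r) (k : ℕ) :
    (l.drop k).count true = (r.drop k).count true + if k = c then 1 else 0 := by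
  induction c using Nat.strong_induction_on generalizing l r k with
  | _ c ih =>
    rcases c with _ | _ | c
    · rcases l with _ | ⟨_ | _, l⟩ <;> simp [removeBox] at h
      subst h; cases k <;> simp
    · rcases l with _ | ⟨_ | _, _ | ⟨_ | _, l⟩⟩ <;> simp [removeBox] at h
      subst h; rcases k with _ | _ | k <;> simp
    · rcases l with _ | ⟨a, l⟩
      · simp [removeBox] at h
      · rw [removeBox, Option.map_eq_some_iff] at h
        obtain ⟨r, hr, rfl⟩ := h
        rcases k with _ | k
        · have := ih (c + 1) (by omega) hr 0
          cases a <;> simpa using this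
        · simpa using ih (c + 1) (by omega) hr k

theorem count_drop_eq_succ_of_removeBox {c : ℕ} {l r : List Bool} (h : removeBox c l = some r) :
    (l.drop c).count true = (l.drop (c + 1)).count true + 1 := by
  have h1 := count_drop_of_removeBox h c
  have h2 := count_drop_of_removeBox h (c + 1)
  have h3 := count_drop_succ_le l c
  have h4 := count_drop_succ_ge r c
  simp at h1 h2
  omega

theorem count_drop_eq_of_removeBox {c : ℕ} {l r : List Bool} (h : removeBox (c + 1) l = some r) :
    (l.drop c).count true = (l.drop (c + 1)).count true := by
  have h1 := count_drop_of_removeBox h c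
  have h2 := count_drop_of_removeBox h (c + 1)
  have h3 := count_drop_succ_le r c
  have h4 := count_drop_succ_ge l c
  simp at h1 h2
  omega

theorem count_drop_of_removeBox_eq_none {c : ℕ} {l : List Bool} (h : removeBox c l = none) :
    (l.drop c).count true = (l.drop (c + 1)).count true ∨
      (1 ≤ c ∧ (l.drop (c - 1)).count true = (l.drop c).count true + 1) := by
  induction c using Nat.strong_induction_on generalizing l with
  | _ c ih =>
    rcases c with _ | _ | c
    · rcases l with _ | ⟨_ | _, l⟩ <;> simp [removeBox] at h ⊢
    · rcases l with _ | ⟨_ | _, _ | ⟨_ | _, l⟩⟩ <;> simp [removeBox] at h ⊢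
    · rcases l with _ | ⟨a, l⟩
      · simp
      · rw [removeBox, Option.map_eq_none_iff] at h
        have := ih (c + 1) (by omega) h
        simpa using this

/-- `b` is a corner of the shape `λ`: the last box of its row and the lowest of its column. -/
structure IsCorner (la : StrictPartition) (b : ℕ × ℕ) : Prop where
  mem : b ∈ la.SD
  row : ∀ j, b.2 < j → (b.1, j) ∉ la.SD
  col : ∀ i, b.1 < i → (i, b.2) ∉ la.SD

/-- A box without right and lower neighbour is removable, and it is the last box on its
diagonal. -/
theorem exists_removeBox_of_corner {l : List Bool} {i j : ℕ} (hm : (i, j) ∈ (ofBits l).SD)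
    (hr : (i, j + 1) ∉ (ofBits l).SD) (hc : (i + 1, j) ∉ (ofBits l).SD) :
    (∃ r, removeBox (j - i) l = some r) ∧ i = (l.drop (j - i)).count true := by
  rw [mem_SD_ofBits] at hm hr hc
  rw [show j + 1 - i = j - i + 1 by omega] at hr
  rw [show j - (i + 1) = j - i - 1 by omega] at hc
  have h1 := count_drop_succ_le l (j - i)
  refine ⟨Option.ne_none_iff_exists'.1 fun h => ?_, by omega⟩
  have := count_drop_of_removeBox_eq_none h
  omega

theorem isCorner_of_removeBox {c : ℕ} {l r : List Bool} (h : removeBox c l = some r) :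
    IsCorner (ofBits l) ((l.drop c).count true, (l.drop c).count true + c) := by
  have h1 := count_drop_eq_succ_of_removeBox h
  refine ⟨?_, fun j hj => ?_, fun i hi => ?_⟩
  · rw [mem_SD_ofBits, Nat.add_sub_cancel_left]
    omega
  · rw [mem_SD_ofBits]
    dsimp only at hj ⊢
    have := count_drop_anti l (c := c + 1) (d := j - (l.drop c).count true) (by omega)
    omega
  · rw [mem_SD_ofBits]
    rintro ⟨-, h3, h4⟩
    obtain ⟨d, rfl⟩ : ∃ d, c = d + 1 := ⟨c - 1, by simp at hi; omega⟩
    have h5 := count_drop_eq_of_removeBox h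
    simp only at hi h3 h4
    have h6 := count_drop_le_add l ((l.drop (d + 1)).count true + (d + 1) - i)
      (i - (l.drop (d + 1)).count true - 1)
    rw [show (l.drop (d + 1)).count true + (d + 1) - i + (i - (l.drop (d + 1)).count true - 1)
      = d by omega] at h6
    omega

theorem SD_removeBox {c : ℕ} {l r : List Bool} (h : removeBox c l = some r) :
    (ofBits r).SD =
      (ofBits l).SD.erase ((l.drop c).count true, (l.drop c).count true + c) := by
  ext ⟨i, j⟩
  rw [Finset.mem_erase, mem_SD_ofBits, mem_SD_ofBits, count_drop_of_removeBox h (j - i)]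
  have h2 := count_drop_of_removeBox h c
  rw [if_pos rfl] at h2
  simp only [ne_eq, Prod.mk.injEq]
  split_ifs with h1
  · subst h1; omega
  · omega

end Shapes

/-! ### Adjoining one letter on one diagonal -/

section Tableaux

variable {la nu : StrictPartition}

/-- The semistandard set-valued shifted tableaux of shape `λ` in which an entry `a` on the diagonal
`j - i = c` has to satisfy `E a c`. -/
def Tab (la : StrictPartition) (E : Entry → ℕ → Prop) : Set (SetTableau la) :=
  {T | T.IsSemistandard ∧ ∀ i j, ∀ a ∈ T.entry (i, j), E a (j - i)}

/-- Allow the letter `a` on the diagonal `c` in addition to what `E` allows. -/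
def adjoin (E : Entry → ℕ → Prop) (a : Entry) (c : ℕ) : Entry → ℕ → Prop :=
  fun a' c' => E a' c' ∨ (a' = a ∧ c' = c)

/-- The letter `a` on diagonal `c` may be adjoined to `E` in such a way that it can only occur in
corners: `a` is the largest letter, and primed letters are allowed from the high diagonals down,
unprimed ones from the main diagonal up. -/
structure IsNext (E : Entry → ℕ → Prop) (a : Entry) (c : ℕ) : Prop where
  le : ∀ a' c', E a' c' → a' ≤ a
  primed : a.IsPrimed → ∀ c', E a c' → c < c'
  unprimed : ¬ a.IsPrimed → ∀ c', E a c' → c' < c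

theorem IsNext.not_mem {E : Entry → ℕ → Prop} {a : Entry} {c : ℕ} (h : IsNext E a c) :
    ¬ E a c := fun hE => by
  by_cases ha : a.IsPrimed
  · exact lt_irrefl _ (h.primed ha c hE)
  · exact lt_irrefl _ (h.unprimed ha c hE)

theorem SetTableau.mem_SD_of_mem (T : SetTableau la) {b : ℕ × ℕ} {a : Entry}
    (h : a ∈ T.entry b) : b ∈ la.SD := (T.nonempty_iff b).1 ⟨a, h⟩

theorem SetTableau.IsSemistandard.mono {T : SetTableau la} (hT : T.IsSemistandard)
    {T' : SetTableau nu} (h : ∀ b, T'.entry b ⊆ T.entry b) : T'.IsSemistandard where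
  row_le i j a ha b hb := hT.row_le i j a (h _ ha) b (h _ hb)
  col_le i j a ha b hb := hT.col_le i j a (h _ ha) b (h _ hb)
  col_unprimed j i₁ i₂ a hp h1 h2 := hT.col_unprimed j i₁ i₂ a hp (h _ h1) (h _ h2)
  row_primed i j₁ j₂ a hp h1 h2 := hT.row_primed i j₁ j₂ a hp (h _ h1) (h _ h2)

def SetTableau.insertAt (T : SetTableau nu) (b : ℕ × ℕ) (a : Entry)
    (h : insert b nu.SD = la.SD) : SetTableau la where
  entry := Function.update T.entry b (insert a (T.entry b))
  nonempty_iff d := by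
    rw [← h]
    rcases eq_or_ne d b with rfl | hd
    · simp
    · simp [hd, T.nonempty_iff]

def SetTableau.eraseAt (T : SetTableau la) (b : ℕ × ℕ) (a : Entry)
    (h : ∀ d, (d ≠ b ∨ ((T.entry b).erase a).Nonempty) ∧ d ∈ la.SD ↔ d ∈ nu.SD) :
    SetTableau nu where
  entry := Function.update T.entry b ((T.entry b).erase a)
  nonempty_iff d := by
    rw [← h d]
    rcases eq_or_ne d b with rfl | hd
    · simp only [Function.update_self, ne_eq, not_true_eq_false, false_or]
      exact ⟨fun h => ⟨h, (T.nonempty_iff _).1 (h.mono (Finset.erase_subset _ _))⟩, And.left⟩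
    · simp [hd, T.nonempty_iff]

/-- Putting the next letter into a corner preserves semistandardness. The new entry is maximal, and
another occurrence of it in the same column (if unprimed) or row (if primed) would lie below or to
the right of the corner. -/
theorem isSemistandard_insertAt {E : Entry → ℕ → Prop} {T : SetTableau nu} (hT : T ∈ Tab nu E)
    {b : ℕ × ℕ} {a : Entry} (ha : IsNext E a (b.2 - b.1)) (hb : IsCorner la b)
    (h : insert b nu.SD = la.SD) : T.insertAt b a h ∈ Tab la (adjoin E a (b.2 - b.1)) := by
  obtain ⟨i₀, j₀⟩ := b
  have hle : i₀ ≤ j₀ := ((la.mem_SD _ _).1 hb.mem).2.1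
  have hsub : nu.SD ⊆ la.SD := h ▸ Finset.subset_insert _ _
  have key : ∀ {i j d}, d ∈ (T.insertAt (i₀, j₀) a h).entry (i, j) →
      d ∈ T.entry (i, j) ∨ (d = a ∧ i = i₀ ∧ j = j₀) := by
    intro i j d hd
    simp only [SetTableau.insertAt, Function.update_apply, Prod.mk.injEq] at hd
    split_ifs at hd with e
    · rw [e.1, e.2]
      rw [Finset.mem_insert] at hd
      tauto
    · exact Or.inl hd
  have hrow : ∀ {j d}, j₀ < j → d ∉ T.entry (i₀, j) := fun hj hd =>
    hb.row _ hj (hsub (T.mem_SD_of_mem hd))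
  have hcol : ∀ {i d}, i₀ < i → d ∉ T.entry (i, j₀) := fun hi hd =>
    hb.col _ hi (hsub (T.mem_SD_of_mem hd))
  have hmax : ∀ {i j d}, d ∈ T.entry (i, j) → d ≤ a := fun hd => ha.le _ _ (hT.2 _ _ _ hd)
  refine ⟨⟨?_, ?_, ?_, ?_⟩, ?_⟩
  · intro i j d hd e he
    rcases key hd with hd' | ⟨rfl, rfl, rfl⟩ <;> rcases key he with he' | ⟨rfl, h1, h2⟩
    · exact hT.1.row_le i j d hd' e he'
    · exact hmax hd'
    · exact absurd he' (hrow (by omega))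
    · rfl
  · intro i j d hd e he
    rcases key hd with hd' | ⟨rfl, rfl, rfl⟩ <;> rcases key he with he' | ⟨rfl, h1, h2⟩
    · exact hT.1.col_le i j d hd' e he'
    · exact hmax hd'
    · exact absurd he' (hcol (by omega))
    · rfl
  · have aux : ∀ {i}, ¬ a.IsPrimed → a ∉ T.entry (i, j₀) := by
      intro i hp hd
      have h1 := ha.unprimed hp _ (hT.2 _ _ _ hd)
      dsimp only at h1
      exact hcol (by omega) hd
    intro j i₁ i₂ d hp hd he
    rcases key hd with hd' | ⟨rfl, rfl, rfl⟩ <;> rcases key he with he' | ⟨h0, h1, h2⟩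
    · exact hT.1.col_unprimed j i₁ i₂ d hp hd' he'
    · subst h0 h2; exact absurd hd' (aux hp)
    · exact absurd he' (aux hp)
    · exact h1.symm
  · have aux : ∀ {j}, a.IsPrimed → a ∉ T.entry (i₀, j) := by
      intro j hp hd
      have h1 := ha.primed hp _ (hT.2 _ _ _ hd)
      dsimp only at h1
      exact hrow (by omega) hd
    intro i j₁ j₂ d hp hd he
    rcases key hd with hd' | ⟨rfl, rfl, rfl⟩ <;> rcases key he with he' | ⟨h0, h1, h2⟩
    · exact hT.1.row_primed i j₁ j₂ d hp hd' he'
    · subst h0 h1; exact absurd hd' (aux hp)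
    · exact absurd he' (aux hp)
    · exact h2.symm
  · intro i j d hd
    rcases key hd with hd | ⟨rfl, rfl, rfl⟩
    · exact Or.inl (hT.2 _ _ _ hd)
    · exact Or.inr ⟨rfl, rfl⟩

/-- The most recently adjoined letter can only occur in a corner: an entry to the right or below is
at least `a`, hence equal to `a`, hence on a diagonal where `a` is not allowed yet or a repetition
that semistandardness forbids. -/
theorem corner_of_mem_adjoin {E : Entry → ℕ → Prop} {a : Entry} {i j : ℕ} {T : SetTableau la}
    (ha : IsNext E a (j - i)) (hT : T ∈ Tab la (adjoin E a (j - i))) (h : a ∈ T.entry (i, j)) :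
    (i, j + 1) ∉ la.SD ∧ (i + 1, j) ∉ la.SD := by
  have hle : i ≤ j := ((la.mem_SD _ _).1 (T.mem_SD_of_mem h)).2.1
  have hmax : ∀ {i' j' d}, d ∈ T.entry (i', j') → a ≤ d → d = a := fun hd hle =>
    le_antisymm ((hT.2 _ _ _ hd).elim (ha.le _ _) (fun e => e.1.le)) hle
  constructor <;> intro hm
  · obtain ⟨d, hd⟩ := (T.nonempty_iff _).2 hm
    obtain rfl := hmax hd (hT.1.row_le i j a h d hd)
    have hE : E d (j + 1 - i) := (hT.2 _ _ _ hd).resolve_right (by omega)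
    by_cases hp : d.IsPrimed
    · have := hT.1.row_primed i _ _ d hp h hd
      omega
    · have := ha.unprimed hp _ hE
      omega
  · have hle' : i + 1 ≤ j := ((la.mem_SD _ _).1 hm).2.1
    obtain ⟨d, hd⟩ := (T.nonempty_iff _).2 hm
    obtain rfl := hmax hd (hT.1.col_le i j a h d hd)
    have hE : E d (j - (i + 1)) := (hT.2 _ _ _ hd).resolve_right (by omega)
    by_cases hp : d.IsPrimed
    · have := ha.primed hp _ hE
      omega
    · have := hT.1.col_unprimed j _ _ d hp h hd
      omega

/-- The weight of a tableau, with arbitrary values `x` for the variables. -/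
def SetTableau.wt {K : Type*} [CommMonoid K] (x : ℕ+ → K) (T : SetTableau la) : K :=
  ∏ b ∈ la.SD, ∏ a ∈ T.entry b, x a.index

/-- The generating function of `Tab la E`. The sum is meaningful if `E` allows only finitely many
letters; see `finite_Tab`. -/
noncomputable def genFun {K : Type*} [CommSemiring K] (x : ℕ+ → K) (la : StrictPartition)
    (E : Entry → ℕ → Prop) : K :=
  ∑ᶠ T : Tab la E, T.1.wt x

theorem wt_insertAt {K : Type*} [CommMonoid K] (x : ℕ+ → K) (T : SetTableau nu) {b : ℕ × ℕ}
    {a : Entry} (h : insert b nu.SD = la.SD) (ha : a ∉ T.entry b) :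
    (T.insertAt b a h).wt x = x a.index * T.wt x := by
  have hT : T.wt x = ∏ d ∈ la.SD, ∏ e ∈ T.entry d, x e.index := by
    refine Finset.prod_subset (h ▸ Finset.subset_insert _ _) fun d _ hd => ?_
    rw [← T.nonempty_iff, Finset.not_nonempty_iff_eq_empty] at hd
    rw [hd, Finset.prod_empty]
  have hb : b ∈ la.SD := h ▸ Finset.mem_insert_self _ _
  rw [hT, SetTableau.wt, ← Finset.mul_prod_erase _ _ hb, ← Finset.mul_prod_erase _ _ hb,
    ← mul_assoc]
  congr 1
  · simp only [SetTableau.insertAt, Function.update_self, Finset.prod_insert ha]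
  · refine Finset.prod_congr rfl fun d hd => ?_
    simp only [SetTableau.insertAt, Function.update_of_ne (Finset.ne_of_mem_erase hd)]

/-- The tableaux that may use `a` in the corner `b` from those that may not: leave a tableau as it
is, or put `a` into a tableau of the same shape, or into one of the shape without `b`. -/
noncomputable def branchMap {E : Entry → ℕ → Prop} {b : ℕ × ℕ} {a : Entry}
    (ha : IsNext E a (b.2 - b.1)) (hb : IsCorner la b) (h : nu.SD = la.SD.erase b) :
    Tab la E ⊕ (Tab la E ⊕ Tab nu E) → Tab la (adjoin E a (b.2 - b.1))
  | .inl T => ⟨T.1, T.2.1, fun i j d hd => Or.inl (T.2.2 i j d hd)⟩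
  | .inr (.inl T) => ⟨T.1.insertAt b a (Finset.insert_eq_self.2 hb.mem),
      isSemistandard_insertAt T.2 ha hb _⟩
  | .inr (.inr T) => ⟨T.1.insertAt b a (h ▸ Finset.insert_erase hb.mem),
      isSemistandard_insertAt T.2 ha hb _⟩

theorem notMem_of_isNext {E : Entry → ℕ → Prop} {b : ℕ × ℕ} {a : Entry}
    (ha : IsNext E a (b.2 - b.1)) (T : Tab la E) : a ∉ T.1.entry b :=
  fun hd => ha.not_mem (T.2.2 _ _ _ hd)

theorem update_insert_injective {F G : ℕ × ℕ → Finset Entry} {b : ℕ × ℕ} {a : Entry}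
    (hF : a ∉ F b) (hG : a ∉ G b)
    (h : Function.update F b (insert a (F b)) = Function.update G b (insert a (G b))) : F = G := by
  funext d
  have hd := congrFun h d
  rcases eq_or_ne d b with rfl | hne
  · rw [Function.update_self, Function.update_self] at hd
    rw [← Finset.erase_insert hF, hd, Finset.erase_insert hG]
  · rwa [Function.update_of_ne hne, Function.update_of_ne hne] at hd

/-- The inverse erases `a` from `b`, which leaves a tableau of the same shape or, if `a` was the only
entry, one of the shape without `b`. -/
theorem branchMap_bijective {E : Entry → ℕ → Prop} {b : ℕ × ℕ} {a : Entry}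
    (ha : IsNext E a (b.2 - b.1)) (hb : IsCorner la b) (h : nu.SD = la.SD.erase b)
    (huniq : ∀ i j, (i, j) ∈ la.SD → (i, j + 1) ∉ la.SD → (i + 1, j) ∉ la.SD →
      j - i = b.2 - b.1 → (i, j) = b) :
    Function.Bijective (branchMap ha hb h) := by
  have hins : ∀ {ka : StrictPartition} (T : Tab ka E) (e : insert b ka.SD = la.SD),
      a ∈ (T.1.insertAt b a e).entry b := fun T e => by simp [SetTableau.insertAt]
  have e1 : insert b la.SD = la.SD := Finset.insert_eq_self.2 hb.mem
  have e2 : insert b nu.SD = la.SD := h ▸ Finset.insert_erase hb.mem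
  constructor
  · have hne : ∀ (T : Tab la E) (T' : Tab nu E), T.1.entry ≠ T'.1.entry := fun T T' e => by
      have h1 := (T.1.nonempty_iff b).2 hb.mem
      rw [e, T'.1.nonempty_iff, h] at h1
      simp at h1
    rintro (T | T | T) (T' | T' | T') e
    · exact congrArg Sum.inl (Subtype.ext (congrArg Subtype.val e :))
    · exact absurd ((congrArg (fun S => a ∈ S.1.entry b) e).mpr (hins T' e1))
        (notMem_of_isNext ha T)
    · exact absurd ((congrArg (fun S => a ∈ S.1.entry b) e).mpr (hins T' e2))
        (notMem_of_isNext ha T)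
    · exact absurd ((congrArg (fun S => a ∈ S.1.entry b) e).mp (hins T e1)) (notMem_of_isNext ha T')
    · have := update_insert_injective (notMem_of_isNext ha T) (notMem_of_isNext ha T')
        (congrArg (fun S => S.1.entry) e)
      rw [Subtype.ext (SetTableau.ext this)]
    · exact absurd (update_insert_injective (notMem_of_isNext ha T) (notMem_of_isNext ha T')
        (congrArg (fun S => S.1.entry) e)) (hne _ _)
    · exact absurd ((congrArg (fun S => a ∈ S.1.entry b) e).mp (hins T e2)) (notMem_of_isNext ha T')
    · exact absurd (update_insert_injective (notMem_of_isNext ha T) (notMem_of_isNext ha T')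
        (congrArg (fun S => S.1.entry) e)).symm (hne _ _)
    · have := update_insert_injective (notMem_of_isNext ha T) (notMem_of_isNext ha T')
        (congrArg (fun S => S.1.entry) e)
      rw [Subtype.ext (SetTableau.ext this)]
  · rintro ⟨T, hT⟩
    have hat : ∀ i j, a ∈ T.entry (i, j) → j - i = b.2 - b.1 → (i, j) = b := fun i j hd e => by
      have := corner_of_mem_adjoin (e ▸ ha) (e ▸ hT) hd
      exact huniq i j (T.mem_SD_of_mem hd) this.1 this.2 e
    have hins : ∀ d, (Function.update T.entry b ((T.entry b).erase a)) d ⊆ T.entry d := fun d => by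
      rcases eq_or_ne d b with rfl | hd
      · simpa using Finset.erase_subset _ _
      · simp [hd]
    have hE : ∀ i j, ∀ d ∈ (Function.update T.entry b ((T.entry b).erase a)) (i, j),
        E d (j - i) := fun i j d hd => by
      refine (hT.2 i j d (hins _ hd)).resolve_right ?_
      rintro ⟨rfl, e⟩
      rw [hat i j (hins _ hd) e] at hd
      simp at hd
    by_cases hab : a ∈ T.entry b
    · by_cases hn : ((T.entry b).erase a).Nonempty
      · have e : ∀ d, (d ≠ b ∨ ((T.entry b).erase a).Nonempty) ∧ d ∈ la.SD ↔ d ∈ la.SD := by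
          simp [hn]
        refine ⟨.inr (.inl ⟨T.eraseAt b a e, hT.1.mono hins, hE⟩), Subtype.ext (SetTableau.ext ?_)⟩
        simp [branchMap, SetTableau.insertAt, SetTableau.eraseAt, Finset.insert_erase hab]
      · have e : ∀ d, (d ≠ b ∨ ((T.entry b).erase a).Nonempty) ∧ d ∈ la.SD ↔ d ∈ nu.SD := by
          simp [hn, h]
        refine ⟨.inr (.inr ⟨T.eraseAt b a e, hT.1.mono hins, hE⟩), Subtype.ext (SetTableau.ext ?_)⟩
        simp [branchMap, SetTableau.insertAt, SetTableau.eraseAt, Finset.insert_erase hab]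
    · refine ⟨.inl ⟨T, hT.1, fun i j d hd => ?_⟩, rfl⟩
      refine (hT.2 i j d hd).resolve_right ?_
      rintro ⟨rfl, e⟩
      rw [hat i j hd e] at hd
      exact hab hd

end Tableaux

/-! ### Generating functions -/

section Branching

theorem finite_Tab (la : StrictPartition) {E : Entry → ℕ → Prop} {L : Set Entry} (hL : L.Finite)
    (hE : ∀ a c, E a c → a ∈ L) : Finite (Tab la E) := by
  classical
  refine Finite.of_injective (β := la.SD → hL.toFinset.powerset)
    (fun T b => ⟨T.1.entry b, Finset.mem_powerset.2 fun a ha =>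
      hL.mem_toFinset.2 (hE _ _ (T.2.2 _ _ _ ha))⟩) fun T T' h => ?_
  refine Subtype.ext (SetTableau.ext (funext fun b => ?_))
  by_cases hb : b ∈ la.SD
  · exact congrArg Subtype.val (congrFun h ⟨b, hb⟩)
  · have h1 := mt (T.1.nonempty_iff b).1 hb
    have h2 := mt (T'.1.nonempty_iff b).1 hb
    rw [Finset.not_nonempty_iff_eq_empty] at h1 h2
    rw [h1, h2]

/-- Allowing one more letter on one diagonal acts on generating functions as `1 + x π_c`. -/
theorem genFun_adjoin {K : Type*} [Field K] (x : ℕ+ → K) {E : Entry → ℕ → Prop} {a : Entry}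
    {c : ℕ} (ha : IsNext E a c) {L : Set Entry} (hL : L.Finite) (hE : ∀ a c, E a c → a ∈ L)
    (l : List Bool) :
    genFun x (ofBits l) (adjoin E a c)
      = boxOp (x a.index) c (fun r => genFun x (ofBits r) E) l := by
  rw [boxOp_eq_removeBox]
  rcases hr : removeBox c l with _ | r
  · have : Tab (ofBits l) (adjoin E a c) = Tab (ofBits l) E := by
      ext T
      refine ⟨fun hT => ⟨hT.1, fun i j d hd => (hT.2 i j d hd).resolve_right ?_⟩,
        fun hT => ⟨hT.1, fun i j d hd => Or.inl (hT.2 i j d hd)⟩⟩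
      rintro ⟨rfl, rfl⟩
      have h1 := corner_of_mem_adjoin ha hT hd
      obtain ⟨⟨r, h2⟩, -⟩ := exists_removeBox_of_corner (T.mem_SD_of_mem hd) h1.1 h1.2
      rw [hr] at h2
      exact absurd h2 (by simp)
    rw [genFun, this, genFun]
  · have hb := isCorner_of_removeBox hr
    have hS := SD_removeBox hr
    have huniq : ∀ i j, (i, j) ∈ (ofBits l).SD → (i, j + 1) ∉ (ofBits l).SD →
        (i + 1, j) ∉ (ofBits l).SD → j - i = c →
        (i, j) = ((l.drop c).count true, (l.drop c).count true + c) := by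
      intro i j h1 h2 h3 h4
      have h5 := (exists_removeBox_of_corner h1 h2 h3).2
      have h6 := ((mem_SD_ofBits l i j).1 h1).2.1
      rw [h4] at h5
      rw [← h5, ← h4, Nat.add_sub_cancel' h6]
    obtain ⟨b, hbc, hbdef⟩ : ∃ b : ℕ × ℕ, b.2 - b.1 = c ∧
        b = ((l.drop c).count true, (l.drop c).count true + c) := ⟨_, by simp, rfl⟩
    rw [← hbdef] at hb hS huniq
    subst hbc
    have := finite_Tab (ofBits l) hL hE
    have := finite_Tab (ofBits r) hL hE
    have hbij := branchMap_bijective ha hb hS huniq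
    have := Finite.of_surjective _ hbij.2
    have := Fintype.ofFinite (Tab (ofBits l) E)
    have := Fintype.ofFinite (Tab (ofBits r) E)
    have := Fintype.ofFinite (Tab (ofBits l) (adjoin E a (b.2 - b.1)))
    simp only [genFun, finsum_eq_sum_of_fintype]
    rw [← hbij.sum_comp, Fintype.sum_sum_type, Fintype.sum_sum_type]
    simp only [branchMap, wt_insertAt x _ _ (notMem_of_isNext ha _), ← Finset.mul_sum]
    ring

theorem genFun_congr {K : Type*} [CommSemiring K] (x : ℕ+ → K) {E E' : Entry → ℕ → Prop}
    (l : List Bool) (h : ∀ a c, c < l.length → (E a c ↔ E' a c)) :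
    genFun x (ofBits l) E = genFun x (ofBits l) E' := by
  have : Tab (ofBits l) E = Tab (ofBits l) E' := by
    ext T
    refine and_congr_right fun _ => forall₂_congr fun i j => forall₂_congr fun a ha => h _ _ ?_
    have h1 := (mem_SD_ofBits l i j).1 (T.mem_SD_of_mem ha)
    by_contra h2
    rw [List.drop_eq_nil_of_le (by omega)] at h1
    simp at h1
    omega
  rw [genFun, this, genFun]

/-- Allowing a new largest primed letter on all diagonals from `c` on. -/
theorem boxOpsDown_genFun {K : Type*} [Field K] (x : ℕ+ → K) {E : Entry → ℕ → Prop} {a : Entry}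
    (ha : a.IsPrimed) {L : Set Entry} (hL : L.Finite) (hE : ∀ a c, E a c → a ∈ L)
    (hlt : ∀ a' c, E a' c → a' < a) (c m : ℕ) (l : List Bool) (hl : l.length = c + m) :
    genFun x (ofBits l) (fun a' d => E a' d ∨ (a' = a ∧ c ≤ d))
      = boxOpsDown (x a.index) c m (fun r => genFun x (ofBits r) E) l := by
  induction m generalizing c l with
  | zero => exact genFun_congr x l fun a' d hd => or_iff_left (by omega)
  | succ m ih =>
    have e : (fun a' d => E a' d ∨ (a' = a ∧ c ≤ d))
        = adjoin (fun a' d => E a' d ∨ (a' = a ∧ c + 1 ≤ d)) a c := by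
      funext a' d
      have : c ≤ d ↔ c + 1 ≤ d ∨ d = c := by omega
      simp only [adjoin, this, or_assoc, and_or_left]
    rw [e, genFun_adjoin x ?_ (hL.insert a) ?_, boxOpsDown]
    · exact boxOp_congr (S := fun r => r.length = c + (m + 1))
        (fun l r h e => (length_of_removeBox e).trans h) (fun r hr => ih (c + 1) r (by omega)) l hl
    · refine ⟨?_, ?_, fun h => absurd ha h⟩
      · rintro a' d (h | h)
        · exact (hlt _ _ h).le
        · exact h.1.le
      · rintro - d (h | h)
        · exact absurd (hlt _ _ h) (lt_irrefl _)
        · exact h.2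
    · rintro a' d (h | h)
      · exact Or.inr (hE _ _ h)
      · exact Or.inl h.1

/-- Allowing a new largest unprimed letter on all diagonals below `c`. -/
theorem boxOpsUp_genFun {K : Type*} [Field K] (x : ℕ+ → K) {E : Entry → ℕ → Prop} {a : Entry}
    (ha : ¬ a.IsPrimed) {L : Set Entry} (hL : L.Finite) (hE : ∀ a c, E a c → a ∈ L)
    (hlt : ∀ a' c, E a' c → a' < a) (c : ℕ) (l : List Bool) :
    genFun x (ofBits l) (fun a' d => E a' d ∨ (a' = a ∧ d < c))
      = boxOpsUp (x a.index) 0 c (fun r => genFun x (ofBits r) E) l := by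
  induction c generalizing l with
  | zero => exact genFun_congr x l fun a' d hd => or_iff_left (by omega)
  | succ c ih =>
    have e : (fun a' d => E a' d ∨ (a' = a ∧ d < c + 1))
        = adjoin (fun a' d => E a' d ∨ (a' = a ∧ d < c)) a c := by
      funext a' d
      have : d < c + 1 ↔ d < c ∨ d = c := by omega
      simp only [adjoin, this, or_assoc, and_or_left]
    rw [e, genFun_adjoin x ?_ (hL.insert a) ?_, boxOpsUp, zero_add]
    · rw [funext ih]
    · refine ⟨?_, fun h => absurd h ha, ?_⟩
      · rintro a' d (h | h)
        · exact (hlt _ _ h).le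
        · exact h.1.le
      · rintro - d (h | h)
        · exact absurd (hlt _ _ h) (lt_irrefl _)
        · exact h.2
    · rintro a' d (h | h)
      · exact Or.inr (hE _ _ h)
      · exact Or.inl h.1

/-- The letters `1' < 1 < ⋯ < n' < n` are allowed everywhere. -/
def allowQ (n : ℕ) : Entry → ℕ → Prop := fun a _ => (a.index : ℕ) ≤ n

/-- The letters `1' < 1 < ⋯ < n' < n` are allowed, the primed ones only off the main diagonal. -/
def allowP (n : ℕ) : Entry → ℕ → Prop := fun a c => (a.index : ℕ) ≤ n ∧ (a.IsPrimed → c ≠ 0)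

theorem finite_letters (n : ℕ) : {a : Entry | (a.index : ℕ) ≤ n}.Finite := by
  have h : {k : ℕ+ | (k : ℕ) ≤ n}.Finite :=
    Set.Finite.preimage (PNat.coe_injective.injOn) (Set.finite_Iic n)
  refine ((h.prod (Set.finite_univ (α := Bool))).image toLex).subset ?_
  intro a ha
  exact ⟨ofLex a, ⟨ha, trivial⟩, rfl⟩

theorem lt_of_index_lt {a b : Entry} (h : a.index < b.index) : a < b :=
  Prod.Lex.toLex_lt_toLex.2 (Or.inl h)

theorem entry_cases {a : Entry} {k : ℕ+} (h : a.index = k) :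
    a = toLex (k, false) ∨ a = toLex (k, true) := by
  subst h
  rcases e : (ofLex a).2 with _ | _
  · exact Or.inl (congrArg toLex (Prod.ext rfl e))
  · exact Or.inr (congrArg toLex (Prod.ext rfl e))

/-- Adding the letters `(n + 1)'` and `n + 1` is the action of the variable `x_{n+1}`. -/
theorem genFun_allow_succ {K : Type*} [Field K] (x : ℕ+ → K) (n N : ℕ) (l : List Bool)
    (hl : l.length = N + 1) :
    genFun x (ofBits l) (allowQ (n + 1))
      = transferQ (x n.succPNat) N (fun r => genFun x (ofBits r) (allowQ n)) l ∧
    genFun x (ofBits l) (allowP (n + 1))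
      = transferP (x n.succPNat) N (fun r => genFun x (ofBits r) (allowP n)) l := by
  have hS : ∀ c l r, List.length l = N + 1 → removeBox c l = some r → r.length = N + 1 :=
    fun c l r h e => (length_of_removeBox e).trans h
  have hp : Entry.IsPrimed (toLex (n.succPNat, false)) := rfl
  have hu : ¬ Entry.IsPrimed (toLex (n.succPNat, true)) := Bool.noConfusion
  have hlt : ∀ (a : Entry) (b : Bool), (a.index : ℕ) ≤ n → a < toLex (n.succPNat, b) :=
    fun a b h => lt_of_index_lt (PNat.coe_lt_coe _ _ |>.1 (by
      change (a.index : ℕ) < n + 1; omega))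
  have hpu : (toLex (n.succPNat, false) : Entry) < toLex (n.succPNat, true) :=
    Prod.Lex.toLex_lt_toLex.2 (Or.inr ⟨rfl, Bool.false_lt_true⟩)
  have hcase : ∀ a : Entry, (a.index : ℕ) ≤ n + 1 ↔ (a.index : ℕ) ≤ n ∨
      a = toLex (n.succPNat, false) ∨ a = toLex (n.succPNat, true) := by
    intro a
    constructor
    · intro h
      rcases Nat.lt_or_ge n a.index with h1 | h1
      · exact Or.inr (entry_cases (PNat.eq (by change (a.index : ℕ) = n + 1; omega)))
      · exact Or.inl h1
    · rintro (h | rfl | rfl)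
      · omega
      · exact le_refl (n + 1)
      · exact le_refl (n + 1)
  have hfin := (finite_letters n).insert (toLex (n.succPNat, false))
  constructor
  · have hV : ∀ r : List Bool, r.length = N + 1 → genFun x (ofBits r) _
        = boxOpsDown (x n.succPNat) 0 (N + 1) (fun r => genFun x (ofBits r) (allowQ n)) r :=
      fun r hr => boxOpsDown_genFun (E := allowQ n) x hp (finite_letters n) (fun a c h => h)
        (fun a c h => hlt a _ h) 0 (N + 1) r (by omega)
    rw [transferQ, ← boxOpsUp_congr hS hV l hl]
    refine Eq.trans ?_ (boxOpsUp_genFun (a := toLex (n.succPNat, true)) x hu hfin ?_ ?_ (N + 1) l)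
    · refine genFun_congr x l fun a c hc => ?_
      have : c < N + 1 := by omega
      simp only [allowQ, hcase, this, Nat.zero_le, and_true, or_assoc]
    · rintro a c (h | h)
      · exact Or.inr h
      · exact Or.inl h.1
    · rintro a c (h | h)
      · exact hlt a _ h
      · exact h.1 ▸ hpu
  · have hV : ∀ r : List Bool, r.length = N + 1 → genFun x (ofBits r) _
        = boxOpsDown (x n.succPNat) 1 N (fun r => genFun x (ofBits r) (allowP n)) r :=
      fun r hr => boxOpsDown_genFun x hp (finite_letters n) (fun a c (h : allowP n a c) => h.1)
        (fun a c h => hlt a _ h.1) 1 N r (by omega)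
    rw [transferP, ← boxOpsUp_congr hS hV l hl]
    refine Eq.trans ?_ (boxOpsUp_genFun (a := toLex (n.succPNat, true)) x hu hfin ?_ ?_ (N + 1) l)
    · refine genFun_congr x l fun a c hc => ?_
      have : c < N + 1 := by omega
      simp only [allowP, hcase, this, and_true, or_assoc, Nat.one_le_iff_ne_zero, or_and_right]
      refine or_congr_right (or_congr ?_ ?_)
      · refine and_congr_right ?_
        rintro rfl
        simp [hp]
      · refine and_iff_left_of_imp ?_
        rintro rfl h
        exact absurd h hu
    · rintro a c (h | h)
      · exact Or.inr h.1
      · exact Or.inl h.1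
    · rintro a c (h | h)
      · exact hlt a _ h.1
      · exact h.1 ▸ hpu

/-- Without letters, only the empty shape has a tableau. -/
theorem genFun_false {K : Type*} [CommSemiring K] (x : ℕ+ → K) {E : Entry → ℕ → Prop}
    (hE : ∀ a c, ¬ E a c) (l : List Bool) :
    genFun x (ofBits l) E = if true ∈ l then 0 else 1 := by
  split_ifs with h
  · have : IsEmpty (Tab (ofBits l) E) := by
      refine ⟨fun T => ?_⟩
      have hm : (1, 1) ∈ (ofBits l).SD := by
        rw [mem_SD_ofBits]
        simpa [Nat.one_le_iff_ne_zero, List.count_eq_zero] using h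
      obtain ⟨a, ha⟩ := (T.1.nonempty_iff _).2 hm
      exact hE _ _ (T.2.2 _ _ _ ha)
    rw [genFun, finsum_of_isEmpty]
  · have h0 : (ofBits l).SD = ∅ := by
      ext ⟨i, j⟩
      rw [mem_SD_ofBits]
      have := (List.drop_sublist (j - i) l).count_le true
      rw [List.count_eq_zero.2 h] at this
      simp only [Finset.notMem_empty, iff_false]
      omega
    have hent : ∀ (T : SetTableau (ofBits l)) b, T.entry b = ∅ := fun T b => by
      rw [← Finset.not_nonempty_iff_eq_empty, T.nonempty_iff, h0]
      simp
    let T₀ : SetTableau (ofBits l) := ⟨fun _ => ∅, by simp [h0]⟩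
    have : Unique (Tab (ofBits l) E) :=
      { default := ⟨T₀, by constructor <;> simp [T₀], by simp [T₀]⟩
        uniq := fun T => Subtype.ext (SetTableau.ext (funext fun b => by
          rw [hent, hent])) }
    rw [genFun, finsum_unique, SetTableau.wt, h0, Finset.prod_empty]

theorem expand_zero {K : Type*} [Field K] (b : Bool) (l : List Bool) :
    expand b (fun _ => (0 : K)) l = 0 := by
  induction l generalizing b with
  | nil => cases b <;> rfl
  | cons a l ih => cases b <;> cases a <;> simp [expand, ih]

theorem expand_indicator {K : Type*} [Field K] (b : Bool) (l : List Bool) :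
    expand b (fun r => if true ∈ r then (0 : K) else 1) l
      = if true ∈ b :: l then 0 else 1 := by
  induction l generalizing b with
  | nil => cases b <;> simp [expand]
  | cons a l ih =>
    cases b <;> cases a <;> simp_all [expand, expand_zero]

/-- The expansion of `Q`-type into `P`-type generating functions in finitely many variables. -/
theorem genFun_allowQ {K : Type*} [Field K] (x : ℕ+ → K) (hx : ∀ k, 1 + x k ≠ 0) (n : ℕ)
    (l : List Bool) (h0 : l ≠ []) (hl : l.getLast? = some false) :
    genFun x (ofBits l) (allowQ n)
      = expand false (fun r => genFun x (ofBits r) (allowP n)) l := by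
  obtain ⟨N, hN⟩ : ∃ N, l.length = N + 1 := Nat.exists_eq_succ_of_ne_zero (by simpa using h0)
  induction n generalizing l with
  | zero =>
    have hQ : ∀ a c, ¬ allowQ 0 a c := fun a c h => by
      have := a.index.pos; simp only [allowQ] at h; omega
    have hP : ∀ a c, ¬ allowP 0 a c := fun a c h => hQ a c h.1
    rw [genFun_false x hQ, funext (genFun_false x hP), expand_indicator]
    simp
  | succ n ih =>
    have hS : ∀ c l r, (List.length l = N + 1 ∧ l.getLast? = some false) → removeBox c l = some r →
        (r.length = N + 1 ∧ r.getLast? = some false) := fun c l r h e =>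
      ⟨(length_of_removeBox e).trans h.1, getLast?_of_removeBox e h.2⟩
    have h1 : genFun x (ofBits l) (allowQ (n + 1)) = transferQ (x n.succPNat) N
        (expand false (fun r => genFun x (ofBits r) (allowP n))) l := by
      rw [(genFun_allow_succ x n N l hN).1]
      refine boxOpsUp_congr hS (fun r hr => boxOpsDown_congr hS (fun r hr => ?_) r hr) l ⟨hN, hl⟩
      exact ih r (by rintro rfl; simp at hr) hr.2 hr.1
    rw [h1, transferQ_expand _ (hx _) N _ l hN hl]
    exact expand_congr false N.succ (fun r hr => ((genFun_allow_succ x n N r hr).2).symm) l hN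

end Branching

/-! ### Numbers of tableaux of a given weight -/

section Counting

theorem map_expand {K K' : Type*} [CommRing K] [CommRing K'] (φ : K →+ K') (b : Bool)
    (f : List Bool → K) (l : List Bool) : φ (expand b f l) = expand b (fun r => φ (f r)) l := by
  induction l generalizing b f with
  | nil => cases b <;> simp [expand]
  | cons a l ih => cases b <;> cases a <;> simp only [expand, two_mul, map_add, map_neg, ih]

/-- The exponents of the weight: `T.content i` is the number of times that `i` or `i'` appears in
`T`. -/
noncomputable def SetTableau.content {la : StrictPartition} (T : SetTableau la) : ℕ+ →₀ ℕ :=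
  ∑ b ∈ la.SD, ∑ a ∈ T.entry b, Finsupp.single a.index 1

theorem wt_X {R : Type*} [CommSemiring R] {la : StrictPartition} (T : SetTableau la) :
    T.wt (fun k => (MvPolynomial.X k : MvPolynomial ℕ+ R)) = MvPolynomial.monomial T.content 1 := by
  simp only [SetTableau.wt, SetTableau.content, MvPolynomial.monomial_sum_one, MvPolynomial.X]

theorem weight_eq {la : StrictPartition} (T : SetTableau la) :
    T.weight = MvPolynomial.monomial T.content 1 := wt_X T

theorem index_mem_support {la : StrictPartition} (T : SetTableau la) {b : ℕ × ℕ} {a : Entry}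
    (h : a ∈ T.entry b) : a.index ∈ T.content.support := by
  have h1 : (T.content a.index) ≠ 0 := by
    have e : T.content a.index
        = ∑ b ∈ la.SD, ∑ a' ∈ T.entry b, Finsupp.single a'.index 1 a.index := by
      simp [SetTableau.content, Finsupp.finsetSum_apply]
    have h2 := Finset.single_le_sum (f := fun b => ∑ a' ∈ T.entry b,
      Finsupp.single a'.index (1 : ℕ) a.index) (fun _ _ => Nat.zero_le _) (T.mem_SD_of_mem h)
    have h3 := Finset.single_le_sum (f := fun a' => Finsupp.single (Entry.index a') (1 : ℕ) a.index)
      (fun _ _ => Nat.zero_le _) h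
    simp only [Finsupp.single_eq_same] at h3
    rw [e]
    exact (Nat.lt_of_lt_of_le (Nat.lt_of_lt_of_le Nat.one_pos h3) h2).ne'
  exact Finsupp.mem_support_iff.2 h1

theorem coeff_genFun {la : StrictPartition} {E : Entry → ℕ → Prop} {L : Set Entry}
    (hL : L.Finite) (hE : ∀ a c, E a c → a ∈ L) (m : ℕ+ →₀ ℕ) :
    (genFun (fun k => (MvPolynomial.X k : MvPolynomial ℕ+ ℤ)) la E).coeff m
      = Nat.card {T : Tab la E // T.1.content = m} := by
  classical
  have := finite_Tab la hL hE
  have := Fintype.ofFinite (Tab la E)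
  rw [genFun, finsum_eq_sum_of_fintype, MvPolynomial.coeff_sum]
  simp only [wt_X, MvPolynomial.coeff_monomial]
  rw [Finset.sum_boole, Nat.card_eq_fintype_card, Fintype.card_subtype]

theorem genFun_map {K K' : Type*} [CommSemiring K] [CommSemiring K'] (φ : K →+* K') (x : ℕ+ → K)
    {la : StrictPartition} {E : Entry → ℕ → Prop} {L : Set Entry}
    (hL : L.Finite) (hE : ∀ a c, E a c → a ∈ L) :
    φ (genFun x la E) = genFun (fun k => φ (x k)) la E := by
  have := finite_Tab la hL hE
  have := Fintype.ofFinite (Tab la E)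
  simp only [genFun, finsum_eq_sum_of_fintype, map_sum, SetTableau.wt, map_prod]

/-- The expansion over the polynomial ring. It is derived over the field of fractions because the
weights of the defects have the denominator `1 + x`. -/
theorem genFun_X_allowQ (n : ℕ) (l : List Bool) (h0 : l ≠ []) (hl : l.getLast? = some false) :
    genFun (fun k => (MvPolynomial.X k : MvPolynomial ℕ+ ℤ)) (ofBits l) (allowQ n)
      = expand false (fun r => genFun (fun k => (MvPolynomial.X k : MvPolynomial ℕ+ ℤ))
          (ofBits r) (allowP n)) l := by
  let F := FractionRing (MvPolynomial ℕ+ ℤ)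
  let φ : MvPolynomial ℕ+ ℤ →+* F := algebraMap _ _
  have hφ : Function.Injective φ := IsFractionRing.injective _ _
  apply hφ
  rw [genFun_map (E := allowQ n) φ _ (finite_letters n) (fun a c h => h)]
  have := map_expand (φ : MvPolynomial ℕ+ ℤ →+ F) false (fun r => genFun (fun k =>
    (MvPolynomial.X k : MvPolynomial ℕ+ ℤ)) (ofBits r) (allowP n)) l
  refine Eq.trans ?_ this.symm
  have e : ∀ r, (φ : MvPolynomial ℕ+ ℤ →+ F) (genFun (fun k =>
      (MvPolynomial.X k : MvPolynomial ℕ+ ℤ)) (ofBits r) (allowP n)) = _ := fun r =>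
    genFun_map φ _ (finite_letters n) (fun a c (h : allowP n a c) => h.1)
  rw [funext e]
  refine genFun_allowQ _ (fun k hk => ?_) n l h0 hl
  have h1 : φ (1 + MvPolynomial.X k) = φ 0 := by simpa using hk
  have h2 := congrArg (MvPolynomial.coeff 0) (hφ h1)
  simp at h2

/-- The number of elements of `SetShYT_Q(λ)` with content `m`. -/
noncomputable def numQ (la : StrictPartition) (m : ℕ+ →₀ ℕ) : ℕ :=
  Nat.card {T : SetShYTQ la // T.1.content = m}

/-- The number of elements of `SetShYT_P(λ)` with content `m`. -/
noncomputable def numP (la : StrictPartition) (m : ℕ+ →₀ ℕ) : ℕ :=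
  Nat.card {T : SetShYTP la // T.1.content = m}

theorem exists_bound (m : ℕ+ →₀ ℕ) : ∃ n : ℕ, ∀ (la : StrictPartition) (T : SetTableau la),
    T.content = m → ∀ b, ∀ a ∈ T.entry b, (a.index : ℕ) ≤ n := by
  refine ⟨m.support.sup (fun k => (k : ℕ)), ?_⟩
  rintro la T rfl b a ha
  exact Finset.le_sup (f := fun k : ℕ+ => (k : ℕ)) (index_mem_support T ha)

theorem exists_num_eq (m : ℕ+ →₀ ℕ) : ∃ n : ℕ, ∀ la : StrictPartition,
    Nonempty ({T : SetShYTQ la // T.1.content = m} ≃ {T : Tab la (allowQ n) // T.1.content = m}) ∧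
    Nonempty ({T : SetShYTP la // T.1.content = m} ≃
      {T : Tab la (allowP n) // T.1.content = m}) := by
  obtain ⟨n, hn⟩ := exists_bound m
  refine ⟨n, fun la => ⟨⟨?_⟩, ⟨?_⟩⟩⟩
  · exact
    { toFun := fun T => ⟨⟨T.1.1, T.1.2, fun i j a ha => hn la _ T.2 _ a ha⟩, T.2⟩
      invFun := fun T => ⟨⟨T.1.1, T.1.2.1⟩, T.2⟩
      left_inv := fun T => rfl
      right_inv := fun T => rfl }
  · exact
    { toFun := fun T => ⟨⟨T.1.1, T.1.2.1, fun i j a ha => ⟨hn la _ T.2 _ a ha, fun hp h0 => by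
          have h1 := ((la.mem_SD _ _).1 (T.1.1.mem_SD_of_mem ha)).2.1
          obtain rfl : i = j := by omega
          exact T.1.2.2 i a ha hp⟩⟩, T.2⟩
      invFun := fun T => ⟨⟨T.1.1, T.1.2.1, fun j a ha hp => (T.1.2.2 j j a ha).2 hp (by simp)⟩, T.2⟩
      left_inv := fun T => rfl
      right_inv := fun T => rfl }

theorem numQ_eq_expand (m : ℕ+ →₀ ℕ) (l : List Bool) (h0 : l ≠ []) (hl : l.getLast? = some false) :
    (numQ (ofBits l) m : ℤ) = expand false (fun r => (numP (ofBits r) m : ℤ)) l := by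
  obtain ⟨n, hn⟩ := exists_num_eq m
  have h := congrArg (MvPolynomial.coeff m) (genFun_X_allowQ n l h0 hl)
  rw [coeff_genFun (E := allowQ n) (finite_letters n) (fun a c h => h)] at h
  rw [numQ, Nat.card_congr (hn _).1.some, h]
  have := map_expand (MvPolynomial.coeffAddMonoidHom m) false (fun r => genFun (fun k =>
    (MvPolynomial.X k : MvPolynomial ℕ+ ℤ)) (ofBits r) (allowP n)) l
  refine Eq.trans this ?_
  congr 1
  funext r
  refine (coeff_genFun (finite_letters n) (fun a c (h : allowP n a c) => h.1) m).trans ?_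
  rw [numP, Nat.card_congr (hn _).2.some]

theorem finite_contentQ (la : StrictPartition) (m : ℕ+ →₀ ℕ) :
    Finite {T : SetShYTQ la // T.1.content = m} := by
  obtain ⟨n, hn⟩ := exists_num_eq m
  have := finite_Tab la (finite_letters n) (E := allowQ n) (fun a c h => h)
  exact Finite.of_equiv _ (hn la).1.some.symm

/-- The entries of the transfer matrix `expand`, as integers; see `siteOp` for the weights. -/
def coef : Bool → List Bool → List Bool → ℤ
  | false, [], [] => 1
  | false, false :: l, false :: r => coef false l r
  | false, true :: l, true :: r => 2 * coef false l r
  | false, true :: l, false :: r => coef true l r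
  | true, false :: l, true :: r => coef false l r
  | true, true :: l, true :: r => - coef true l r
  | _, _, _ => 0

/-- The bit lists of length `n`. -/
def bitLists : ℕ → Finset (List Bool)
  | 0 => {[]}
  | n + 1 => (bitLists n).image (List.cons false) ∪ (bitLists n).image (List.cons true)

theorem mem_bitLists (n : ℕ) (r : List Bool) : r ∈ bitLists n ↔ r.length = n := by
  induction n generalizing r with
  | zero => simp [bitLists]
  | succ n ih => rcases r with _ | ⟨_ | _, r⟩ <;> simp [bitLists, ih]

theorem sum_bitLists_succ {K : Type*} [AddCommMonoid K] (n : ℕ) (f : List Bool → K) :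
    ∑ r ∈ bitLists (n + 1), f r
      = ∑ r ∈ bitLists n, f (false :: r) + ∑ r ∈ bitLists n, f (true :: r) := by
  rw [bitLists, Finset.sum_union, Finset.sum_image (by simp), Finset.sum_image (by simp)]
  rw [Finset.disjoint_left]
  simp +contextual

theorem expand_eq_sum (b : Bool) (f : List Bool → ℤ) (l : List Bool) :
    expand b f l = ∑ r ∈ bitLists l.length, coef b l r * f r := by
  induction l generalizing b f with
  | nil => cases b <;> simp [expand, bitLists, coef]
  | cons a l ih =>
    rw [List.length_cons, sum_bitLists_succ]
    cases b <;> cases a <;> simp [expand, coef, ih, Finset.mul_sum, mul_assoc, add_comm]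

end Counting

/-! ### The coefficients as signs and powers of two -/

section Strips

open StrictPartition

/-- The condition for `coef b l r ≠ 0` in terms of the numbers of boxes on the diagonals: `r` has at
most one more box than `l` on each diagonal and never fewer, it has one more on the main diagonal
iff `b`, and additional boxes on neighbouring diagonals are not in the same row. -/
def IsAdmissible (b : Bool) (l r : List Bool) : Prop :=
  r.count true = l.count true + b.toNat ∧ ∀ c,
    (l.drop c).count true ≤ (r.drop c).count true ∧
    (r.drop c).count true ≤ (l.drop c).count true + 1 ∧
    ¬ ((r.drop c).count true = (l.drop c).count true + 1 ∧
      (r.drop (c + 1)).count true = (l.drop (c + 1)).count true + 1 ∧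
      (r.drop c).count true = (r.drop (c + 1)).count true)

theorem coef_ne_zero_iff (b : Bool) (l r : List Bool) (h : r.length = l.length) :
    coef b l r ≠ 0 ↔ IsAdmissible b l r := by
  induction l generalizing b r with
  | nil =>
    obtain rfl := List.length_eq_zero_iff.1 h
    cases b <;> simp [coef, IsAdmissible]
  | cons m l ih =>
    rcases r with _ | ⟨a, r⟩
    · simp at h
    have h' : r.length = l.length := by simpa using h
    have ihf := ih false r h'
    have iht := ih true r h'
    unfold IsAdmissible at ihf iht ⊢
    rw [← Nat.and_forall_add_one]
    have hf : ∀ r : List Bool, (false :: r).count true = r.count true := by simp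
    have ht : ∀ r : List Bool, (true :: r).count true = r.count true + 1 := by simp
    simp only [List.drop_zero, List.drop_succ_cons, zero_add]
    cases b <;> cases m <;> cases a <;>
      simp only [coef, ne_eq, mul_eq_zero, neg_eq_zero, OfNat.ofNat_ne_zero, false_or, ihf, iht,
        hf, ht, Bool.toNat_false, Bool.toNat_true, not_true_eq_false, false_iff, add_zero]
    · refine ⟨fun ⟨h1, h2⟩ => ⟨by omega, ?_, h2⟩, fun ⟨h1, _, h2⟩ => ⟨by omega, h2⟩⟩
      have := h2 0
      simp only [List.drop_zero, zero_add] at this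
      omega
    · rintro ⟨h1, h0, h2⟩
      have := h2 0
      simp only [List.drop_zero, zero_add] at this
      omega
    · refine ⟨fun ⟨h1, h2⟩ => ⟨by omega, ?_, h2⟩, fun ⟨h1, _, h2⟩ => ⟨by omega, h2⟩⟩
      have := h2 0
      simp only [List.drop_zero, zero_add] at this
      omega
    · refine ⟨fun ⟨h1, h2⟩ => ⟨by omega, ?_, h2⟩, fun ⟨h1, _, h2⟩ => ⟨by omega, h2⟩⟩
      have := h2 0
      simp only [List.drop_zero, zero_add] at this
      omega
    · rintro ⟨h1, h0, -⟩
      simp [h1] at h0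
    · refine ⟨fun ⟨h1, h2⟩ => ⟨by omega, ?_, h2⟩, fun ⟨h1, _, h2⟩ => ⟨by omega, h2⟩⟩
      have := h2 0
      simp only [List.drop_zero, zero_add] at this
      omega
    · rintro ⟨h1, h0, h2⟩
      have := h2 0
      simp only [List.drop_zero, zero_add] at this
      omega
    · refine ⟨fun ⟨h1, h2⟩ => ⟨by omega, ?_, h2⟩, fun ⟨h1, _, h2⟩ => ⟨by omega, h2⟩⟩
      have := h2 0
      simp only [List.drop_zero, zero_add] at this
      omega

theorem lt_part_ofBits (l : List Bool) {c i : ℕ} (hi : 1 ≤ i) :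
    c < (ofBits l).part i ↔ i ≤ (l.drop c).count true := by
  rw [part]
  exact (lt_getD_partsOf l c (i - 1)).trans (by omega)

theorem length_ofBits (l : List Bool) : (ofBits l).length = l.count true := by
  have h : (partsOf l).length = l.count true := by
    induction l with
    | nil => rfl
    | cons a l ih => cases a <;> simp [partsOf, ih]
  exact h

theorem mem_skewSD_ofBits (l r : List Bool) (i j : ℕ) :
    (i, j) ∈ skewSD (ofBits r) (ofBits l) ↔ 0 < i ∧ i ≤ j ∧ i ≤ (r.drop (j - i)).count true ∧
      (l.drop (j - i)).count true < i := by
  rw [skewSD, Finset.mem_sdiff, mem_SD_ofBits, mem_SD_ofBits]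
  omega

theorem ofBits_mem_Lam_iff (l r : List Bool) :
    ofBits r ∈ Lam (ofBits l) ↔ IsAdmissible false l r := by
  have hmem : ∀ i c, (i, i + c) ∈ skewSD (ofBits r) (ofBits l) ↔
      0 < i ∧ i ≤ (r.drop c).count true ∧ (l.drop c).count true < i := fun i c => by
    rw [mem_skewSD_ofBits, Nat.add_sub_cancel_left]
    omega
  constructor
  · rintro ⟨hcont, hlen, hstrip⟩
    rw [length_ofBits, length_ofBits] at hlen
    -- two additional boxes in neighbouring diagonals of one row contradict the strip condition
    have key : ∀ i c, 0 < i → (l.drop c).count true < i → (l.drop (c + 1)).count true < i →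
        i ≤ (r.drop c).count true → i ≤ (r.drop (c + 1)).count true → False := by
      intro i c h0 h1 h2 h3 h4
      have := hstrip _ ((hmem i c).2 ⟨h0, h3, h1⟩) _ ((hmem i (c + 1)).2 ⟨h0, h4, h2⟩) rfl
      simp at this
    refine ⟨hlen, fun c => ⟨?_, ?_, ?_⟩⟩
    · by_contra h
      have h1 := (lt_part_ofBits l (c := c) (i := (l.drop c).count true) (by omega)).2 le_rfl
      have h2 := hcont _ (show 1 ≤ (l.drop c).count true by omega)
      have := (lt_part_ofBits r (by omega)).1 (h1.trans_le h2)
      omega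
    · by_contra h
      have h1 := count_drop_succ_le r c
      have h2 := count_drop_succ_ge l c
      exact key ((l.drop c).count true + 1) c (by omega) (by omega) (by omega) (by omega) (by omega)
    · rintro ⟨h1, h2, h3⟩
      exact key _ c (by omega) (by omega) (by omega) le_rfl h3.le
  · rintro ⟨hlen, h⟩
    refine ⟨fun i hi => le_of_forall_lt fun c hc => ?_, ?_, ?_⟩
    · rw [lt_part_ofBits _ hi] at hc ⊢
      exact hc.trans (h c).1
    · rw [length_ofBits, length_ofBits]
      exact hlen
    · have key : ∀ i c d, c < d → (i, i + c) ∈ skewSD (ofBits r) (ofBits l) →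
          (i, i + d) ∈ skewSD (ofBits r) (ofBits l) → False := by
        intro i c d hcd hc hd
        rw [hmem] at hc hd
        have h1 := h c
        have h2 := h (c + 1)
        have h3 := count_drop_anti r (c := c + 1) (d := d) hcd
        have h4 := count_drop_succ_ge l c
        have h5 := count_drop_succ_ge r c
        omega
      rintro ⟨i, j⟩ h1 ⟨i', k⟩ h2 (rfl : i = i')
      have hj := ((mem_skewSD_ofBits _ _ _ _).1 h1).2.1
      have hk := ((mem_skewSD_ofBits _ _ _ _).1 h2).2.1
      obtain ⟨c, rfl⟩ := Nat.exists_eq_add_of_le hj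
      obtain ⟨d, rfl⟩ := Nat.exists_eq_add_of_le hk
      rcases lt_trichotomy c d with hcd | rfl | hcd
      · exact (key i c d hcd h1 h2).elim
      · rfl
      · exact (key i d c hcd h2 h1).elim

theorem skewSD_cons (m a : Bool) (l r : List Bool) (b : Bool)
    (h : (a :: r).count true = (m :: l).count true + b.toNat) :
    skewSD (ofBits (a :: r)) (ofBits (m :: l)) =
      (skewSD (ofBits r) (ofBits l)).image (fun p => (p.1, p.2 + 1)) ∪
        (if b then {((a :: r).count true, (a :: r).count true)} else ∅) := by
  ext ⟨i, j⟩
  rw [Finset.mem_union, Finset.mem_image, mem_skewSD_ofBits]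
  have hb : (i, j) ∈ (if b then {((a :: r).count true, (a :: r).count true)} else
      (∅ : Finset (ℕ × ℕ))) ↔ i = j ∧ i ≤ (a :: r).count true ∧ (m :: l).count true < i := by
    cases b
    · simp only [Bool.toNat_false] at h
      simp only [Bool.false_eq_true, if_false, Finset.notMem_empty, false_iff]
      omega
    · simp only [Bool.toNat_true] at h
      simp only [if_true, Finset.mem_singleton, Prod.mk.injEq]
      omega
  rw [hb]
  rcases lt_trichotomy i j with hij | rfl | hij
  · obtain ⟨d, rfl⟩ : ∃ d, j = i + d + 1 := ⟨j - i - 1, by omega⟩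
    rw [show i + d + 1 - i = d + 1 by omega, List.drop_succ_cons, List.drop_succ_cons]
    constructor
    · rintro ⟨h1, h2, h3, h4⟩
      refine Or.inl ⟨(i, i + d), ?_, rfl⟩
      rw [mem_skewSD_ofBits, Nat.add_sub_cancel_left]
      exact ⟨h1, by omega, h3, h4⟩
    · rintro (⟨⟨i', j'⟩, h1, h2⟩ | h1)
      · obtain ⟨rfl, h3⟩ := Prod.mk.inj h2
        dsimp only at h3
        obtain rfl : j' = i' + d := by omega
        rw [mem_skewSD_ofBits, Nat.add_sub_cancel_left] at h1
        exact ⟨h1.1, by omega, h1.2.2⟩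
      · omega
  · rw [Nat.sub_self, List.drop_zero, List.drop_zero]
    constructor
    · rintro ⟨h1, h2, h3, h4⟩
      exact Or.inr ⟨rfl, h3, h4⟩
    · rintro (⟨⟨i', j'⟩, h1, h2⟩ | h1)
      · obtain ⟨rfl, h3⟩ := Prod.mk.inj h2
        dsimp only at h3
        rw [mem_skewSD_ofBits] at h1
        omega
      · exact ⟨by omega, le_rfl, h1.2⟩
  · constructor
    · omega
    · rintro (⟨⟨i', j'⟩, h1, h2⟩ | h1)
      · obtain ⟨rfl, h3⟩ := Prod.mk.inj h2
        dsimp only at h3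
        rw [mem_skewSD_ofBits] at h1
        omega
      · omega

/-- The value of a nonzero coefficient. Prefixing a bit to both lists shifts the skew diagram by one
column and adds a box on the main diagonal if `b`. The last two claims locate the leftmost column of
the skew diagram, which decides whether this box occupies a new column. -/
theorem coef_eq (b : Bool) (l r : List Bool) (h : r.length = l.length) (hc : coef b l r ≠ 0) :
    coef b l r = (-1) ^ (cols (ofBits r) (ofBits l) + skewSize (ofBits r) (ofBits l))
        * 2 ^ (r.count true - skewSize (ofBits r) (ofBits l)) ∧
      skewSize (ofBits r) (ofBits l) ≤ r.count true ∧
      (b = true → (r.count true, r.count true) ∈ skewSD (ofBits r) (ofBits l) ∧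
        ∀ p ∈ skewSD (ofBits r) (ofBits l), r.count true ≤ p.2) ∧
      (b = false → ∀ p ∈ skewSD (ofBits r) (ofBits l), r.count true < p.2) := by
  induction l generalizing b r with
  | nil =>
    obtain rfl := List.length_eq_zero_iff.1 h
    cases b <;> simp [coef, cols, skewSize, skewSD] at hc ⊢
  | cons m l ih =>
    rcases r with _ | ⟨a, r⟩
    · simp at h
    have h' : r.length = l.length := by simpa using h
    have h_adm := (coef_ne_zero_iff b _ _ h).1 hc
    have hsk := skewSD_cons m a l r b h_adm.1
    set D := skewSD (ofBits r) (ofBits l) with hD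
    set n := (a :: r).count true with hn
    have hinj : Function.Injective (fun p : ℕ × ℕ => (p.1, p.2 + 1)) := fun p q e => by
      simpa [Prod.ext_iff] using e
    have hdisj : (n, n) ∉ D.image (fun p => (p.1, p.2 + 1)) := by
      rw [Finset.mem_image]
      rintro ⟨⟨i, j⟩, h1, h2⟩
      rw [hD, mem_skewSD_ofBits] at h1
      simp only [Prod.mk.injEq] at h2
      omega
    have hsnd : (D.image (fun p => (p.1, p.2 + 1))).image Prod.snd
        = (D.image Prod.snd).image (· + 1) := by
      simp only [Finset.image_image]; rfl
    have hcard : ((D.image Prod.snd).image (· + 1)).card = (D.image Prod.snd).card :=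
      Finset.card_image_of_injective _ (add_left_injective 1)
    have hmemn : n ∈ (D.image Prod.snd).image (· + 1) ↔ ∃ p ∈ D, p.2 + 1 = n := by
      simp only [Finset.mem_image, exists_exists_and_eq_and]
    have hfalse : b = false → skewSize (ofBits (a :: r)) (ofBits (m :: l)) = D.card ∧
        cols (ofBits (a :: r)) (ofBits (m :: l)) = (D.image Prod.snd).card := by
      rintro rfl
      rw [skewSize, cols, hsk]
      simp only [Bool.false_eq_true, if_false, Finset.union_empty]
      rw [hsnd, hcard, Finset.card_image_of_injective _ hinj]
      exact ⟨rfl, rfl⟩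
    have htrue : b = true → skewSize (ofBits (a :: r)) (ofBits (m :: l)) = D.card + 1 ∧
        cols (ofBits (a :: r)) (ofBits (m :: l)) = (D.image Prod.snd).card +
          if ∃ p ∈ D, p.2 + 1 = n then 0 else 1 := by
      rintro rfl
      rw [skewSize, cols, hsk]
      simp only [if_true]
      rw [Finset.image_union, Finset.image_singleton, hsnd, ← hcard, Finset.union_comm,
        Finset.union_comm _ {n}, ← Finset.insert_eq, ← Finset.insert_eq,
        Finset.card_insert_of_notMem hdisj, Finset.card_image_of_injective _ hinj]
      refine ⟨rfl, ?_⟩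
      split_ifs with hp
      · rw [Finset.insert_eq_self.2 (hmemn.2 hp), add_zero]
      · rw [Finset.card_insert_of_notMem (mt hmemn.1 hp)]
    have hmem : ∀ p ∈ skewSD (ofBits (a :: r)) (ofBits (m :: l)),
        (∃ q ∈ D, p.2 = q.2 + 1) ∨ (b = true ∧ p.2 = n) := by
      intro p hp
      rw [hsk, Finset.mem_union] at hp
      rcases hp with hp | hp
      · obtain ⟨q, hq, rfl⟩ := Finset.mem_image.1 hp
        exact Or.inl ⟨q, hq, rfl⟩
      · split_ifs at hp with hb
        · rw [Finset.mem_singleton] at hp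
          exact Or.inr ⟨hb, by rw [hp]⟩
        · simp at hp
    have hmem2 : b = true → (n, n) ∈ skewSD (ofBits (a :: r)) (ofBits (m :: l)) := by
      rintro rfl
      rw [hsk]; simp
    have hsz : skewSize (ofBits r) (ofBits l) = D.card := rfl
    have hcl : cols (ofBits r) (ofBits l) = (D.image Prod.snd).card := rfl
    have hf : ∀ r : List Bool, (false :: r).count true = r.count true := by simp
    have ht : ∀ r : List Bool, (true :: r).count true = r.count true + 1 := by simp
    have ihf := ih false r h'
    have iht := ih true r h'
    rw [hsz, hcl, ← hD] at ihf iht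
    clear_value D
    cases b
    · rw [(hfalse rfl).1, (hfalse rfl).2]
      cases m <;> cases a
      · obtain ⟨e1, e2, -, e4⟩ := ihf hc
        rw [hf] at hn
        refine ⟨by rw [coef, e1, hn], by omega, nofun, fun _ p hp => ?_⟩
        obtain ⟨q, hq, h2⟩ | h2 := hmem p hp
        · have := e4 rfl q hq; omega
        · simp at h2
      · exact absurd rfl hc
      · obtain ⟨e1, e2, e3, -⟩ := iht hc
        rw [hf] at hn
        refine ⟨by rw [coef, e1, hn], by omega, nofun, fun _ p hp => ?_⟩
        obtain ⟨q, hq, h2⟩ | h2 := hmem p hp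
        · have := (e3 rfl).2 q hq; omega
        · simp at h2
      · obtain ⟨e1, e2, -, e4⟩ := ihf (right_ne_zero_of_mul hc)
        rw [ht] at hn
        refine ⟨?_, by omega, nofun, fun _ p hp => ?_⟩
        · rw [coef, e1, hn, Nat.sub_add_comm e2, pow_succ]
          ring
        · obtain ⟨q, hq, h2⟩ | h2 := hmem p hp
          · have := e4 rfl q hq; omega
          · simp at h2
    · rw [(htrue rfl).1, (htrue rfl).2]
      cases m <;> cases a
      · exact absurd rfl hc
      · obtain ⟨e1, e2, -, e4⟩ := ihf hc
        rw [ht] at hn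
        -- the new diagonal box occupies a column of its own
        have hno : ¬ ∃ p ∈ D, p.2 + 1 = n := by
          rintro ⟨p, hp, h2⟩
          have := e4 rfl p hp; omega
        refine ⟨?_, by omega, fun _ => ⟨hmem2 rfl, fun p hp => ?_⟩, nofun⟩
        · rw [coef, e1, if_neg hno, hn, Nat.add_sub_add_right]
          ring
        · obtain ⟨q, hq, h2⟩ | h2 := hmem p hp
          · have := e4 rfl q hq; omega
          · omega
      · exact absurd rfl hc
      · obtain ⟨e1, e2, e3, -⟩ := iht (neg_ne_zero.1 hc)
        rw [ht] at hn
        -- the new diagonal box lies in the column of the previous one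
        have hyes : ∃ p ∈ D, p.2 + 1 = n := ⟨_, (e3 rfl).1, hn.symm⟩
        refine ⟨?_, by omega, fun _ => ⟨hmem2 rfl, fun p hp => ?_⟩, nofun⟩
        · rw [coef, e1, if_pos hyes, hn, Nat.add_sub_add_right]
          ring
        · obtain ⟨q, hq, h2⟩ | h2 := hmem p hp
          · have := (e3 rfl).2 q hq; omega
          · omega

end Strips

/-! ### Priming the largest entries of diagonal boxes -/

section Priming

namespace Entry

/-- Add a prime: `i ↦ i'` and `i' ↦ i'`. -/
def prime (a : Entry) : Entry := toLex (a.index, false)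

theorem isPrimed_prime (a : Entry) : a.prime.IsPrimed := rfl

theorem prime_unprime {a : Entry} (h : a.IsPrimed) : a.unprime.prime = a :=
  congrArg toLex (Prod.ext rfl (Eq.symm h))

theorem unprime_of_not_isPrimed {a : Entry} (h : ¬ a.IsPrimed) : a.unprime = a :=
  congrArg toLex (Prod.ext rfl (Eq.symm ((Bool.not_eq_false _).mp h)))

theorem le_unprime (a : Entry) : a ≤ a.unprime :=
  Prod.Lex.toLex_le_toLex.2 (Or.inr ⟨rfl, Bool.le_true _⟩)

theorem prime_le (a : Entry) : a.prime ≤ a :=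
  Prod.Lex.toLex_le_toLex.2 (Or.inr ⟨rfl, Bool.false_le _⟩)

theorem le_prime_of_lt {a b : Entry} (h : b < a) : b ≤ a.prime := by
  rcases (Prod.Lex.lt_iff).1 h with h | ⟨h, h2⟩
  · exact Prod.Lex.toLex_le_toLex.2 (Or.inl h)
  · refine Prod.Lex.toLex_le_toLex.2 (Or.inr ⟨h, ?_⟩)
    have : (ofLex b).2 = false := by
      revert h2; cases (ofLex b).2 <;> cases (ofLex a).2 <;> simp
    exact this.le

theorem prime_ne {a : Entry} (h : ¬ a.IsPrimed) : a.prime ≠ a := fun e => h (e ▸ a.isPrimed_prime)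

end Entry

/-- Add a prime to the largest element of a finite set of entries. -/
def primeMaxSet (S : Finset Entry) : Finset Entry :=
  if h : S.Nonempty then insert (S.max' h).prime (S.erase (S.max' h)) else ∅

theorem exists_eq_insert_max {S : Finset Entry} (h : S.Nonempty) :
    ∃ a S', S = insert a S' ∧ ∀ b ∈ S', b < a :=
  ⟨S.max' h, S.erase (S.max' h), (Finset.insert_erase (S.max'_mem h)).symm, fun _ hb =>
    S.lt_max'_of_mem_erase_max' h hb⟩

theorem max'_insert {a : Entry} {S : Finset Entry} (h : ∀ b ∈ S, b < a) :
    (insert a S).max' (Finset.insert_nonempty a S) = a :=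
  le_antisymm (Finset.max'_le _ _ _ fun b hb => by
    rcases Finset.mem_insert.1 hb with rfl | hb
    · exact le_rfl
    · exact (h b hb).le) (Finset.le_max' _ _ (Finset.mem_insert_self _ _))

theorem unprimeMaxSet_insert {a : Entry} {S : Finset Entry} (h : ∀ b ∈ S, b < a) :
    unprimeMaxSet (insert a S) = insert a.unprime S := by
  rw [unprimeMaxSet, dif_pos (Finset.insert_nonempty a S), max'_insert h,
    Finset.erase_insert fun ha => lt_irrefl _ (h a ha)]

theorem primeMaxSet_insert {a : Entry} {S : Finset Entry} (h : ∀ b ∈ S, b < a) :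
    primeMaxSet (insert a S) = insert a.prime S := by
  rw [primeMaxSet, dif_pos (Finset.insert_nonempty a S), max'_insert h,
    Finset.erase_insert fun ha => lt_irrefl _ (h a ha)]

theorem unprimeMaxSet_of_unprimed {S : Finset Entry} (h : ∀ a ∈ S, ¬ a.IsPrimed) :
    unprimeMaxSet S = S := by
  rcases S.eq_empty_or_nonempty with rfl | hS
  · simp [unprimeMaxSet]
  · obtain ⟨a, S', rfl, hlt⟩ := exists_eq_insert_max hS
    rw [unprimeMaxSet_insert hlt, Entry.unprime_of_not_isPrimed (h a (Finset.mem_insert_self _ _))]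

theorem unprimeMaxSet_primeMaxSet {S : Finset Entry} (h : ∀ a ∈ S, ¬ a.IsPrimed) :
    unprimeMaxSet (primeMaxSet S) = S := by
  rcases S.eq_empty_or_nonempty with rfl | hS
  · simp [primeMaxSet, unprimeMaxSet]
  · obtain ⟨a, S', rfl, hlt⟩ := exists_eq_insert_max hS
    rw [primeMaxSet_insert hlt, unprimeMaxSet_insert, show a.prime.unprime = a.unprime from rfl,
      Entry.unprime_of_not_isPrimed (h a (Finset.mem_insert_self _ _))]
    intro b hb
    refine lt_of_le_of_ne (Entry.le_prime_of_lt (hlt b hb)) ?_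
    rintro rfl
    exact h _ (Finset.mem_insert_of_mem hb) a.isPrimed_prime

theorem primeMaxSet_unprimeMaxSet {S : Finset Entry} (h : ∃ a ∈ S, a.IsPrimed)
    (h' : ∀ a ∈ unprimeMaxSet S, ¬ a.IsPrimed) : primeMaxSet (unprimeMaxSet S) = S := by
  obtain ⟨a, S', rfl, hlt⟩ := exists_eq_insert_max (h.imp fun _ h => h.1)
  rw [unprimeMaxSet_insert hlt] at h' ⊢
  have ha : a.IsPrimed := by
    obtain ⟨c, hc, hcp⟩ := h
    rcases Finset.mem_insert.1 hc with rfl | hc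
    · exact hcp
    · exact absurd hcp (h' c (Finset.mem_insert_of_mem hc))
  rw [primeMaxSet_insert fun b hb => (hlt b hb).trans_le a.le_unprime, Entry.prime_unprime ha]

theorem primeMaxSet_nonempty (S : Finset Entry) : (primeMaxSet S).Nonempty ↔ S.Nonempty := by
  unfold primeMaxSet
  split_ifs with h <;> simp [h]

theorem exists_isPrimed_primeMaxSet {S : Finset Entry} (h : S.Nonempty) :
    ∃ a ∈ primeMaxSet S, a.IsPrimed := by
  obtain ⟨a, S', rfl, hlt⟩ := exists_eq_insert_max h
  exact ⟨a.prime, by rw [primeMaxSet_insert hlt]; exact Finset.mem_insert_self _ _, rfl⟩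

theorem mem_primeMaxSet {S : Finset Entry} {e : Entry} (h : e ∈ primeMaxSet S) :
    e ∈ S ∨ ∃ a ∈ S, e = a.prime ∧ ∀ b ∈ S, b ≤ a := by
  have hS : S.Nonempty := (primeMaxSet_nonempty S).1 ⟨e, h⟩
  obtain ⟨a, S', rfl, hlt⟩ := exists_eq_insert_max hS
  rw [primeMaxSet_insert hlt] at h
  rcases Finset.mem_insert.1 h with rfl | h
  · refine Or.inr ⟨a, Finset.mem_insert_self _ _, rfl, fun b hb => ?_⟩
    rcases Finset.mem_insert.1 hb with rfl | hb
    · exact le_rfl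
    · exact (hlt b hb).le
  · exact Or.inl (Finset.mem_insert_of_mem h)

theorem sum_unprimeMaxSet {M : Type*} [AddCommMonoid M] (f : ℕ+ → M) (S : Finset Entry)
    (h : ∀ a ∈ unprimeMaxSet S, ¬ a.IsPrimed) :
    ∑ a ∈ unprimeMaxSet S, f a.index = ∑ a ∈ S, f a.index := by
  rcases S.eq_empty_or_nonempty with rfl | hS
  · simp [unprimeMaxSet]
  · obtain ⟨a, S', rfl, hlt⟩ := exists_eq_insert_max hS
    rw [unprimeMaxSet_insert hlt, Finset.sum_insert fun ha => lt_irrefl _ (hlt a ha),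
      Finset.sum_insert fun ha => lt_irrefl _ ((hlt _ ha).trans_le a.le_unprime)]
    rfl

variable {la : StrictPartition}

/-- Rows increase also between boxes that are not adjacent, as the boxes in between are
nonempty. -/
theorem SetTableau.IsSemistandard.row_le_of_lt {T : SetTableau la} (hT : T.IsSemistandard)
    {i j : ℕ} (h : i < j) {a e : Entry} (ha : a ∈ T.entry (i, i)) (he : e ∈ T.entry (i, j)) :
    a ≤ e := by
  induction j, h using Nat.le_induction generalizing e with
  | base => exact hT.row_le i i a ha e he
  | succ j hj ih =>
    have hm := (la.mem_SD _ _).1 (T.mem_SD_of_mem he)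
    obtain ⟨d, hd⟩ := (T.nonempty_iff (i, j)).2 ((la.mem_SD _ _).2 ⟨hm.1, by omega, by omega⟩)
    exact (ih hd).trans (hT.row_le i j d hd e he)

/-- Add a prime to the largest element of the diagonal boxes `(i, i)` with `i ∈ I`. -/
def SetTableau.primeMaxDiag (T : SetTableau la) (I : Finset ℕ) : SetTableau la where
  entry b := if b.1 = b.2 ∧ b.1 ∈ I then primeMaxSet (T.entry b) else T.entry b
  nonempty_iff b := by
    split_ifs
    · rw [primeMaxSet_nonempty, T.nonempty_iff]
    · exact T.nonempty_iff b

theorem SetTableau.IsSemistandard.primeMaxDiag {T : SetTableau la} (hT : T.IsSemistandard)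
    (hd : ∀ j, ∀ a ∈ T.entry (j, j), ¬ a.IsPrimed) (I : Finset ℕ) :
    (T.primeMaxDiag I).IsSemistandard := by
  have key : ∀ {i j e}, e ∈ (T.primeMaxDiag I).entry (i, j) → e ∈ T.entry (i, j) ∨
      (i = j ∧ ∃ a ∈ T.entry (i, j), e = a.prime ∧ ∀ b ∈ T.entry (i, j), b ≤ a) := by
    intro i j e he
    simp only [SetTableau.primeMaxDiag] at he
    split_ifs at he with h
    · exact (mem_primeMaxSet he).imp_right fun h' => ⟨h.1, h'⟩
    · exact Or.inl he
  have hle : ∀ {i j e}, e ∈ T.entry (i, j) → i ≤ j := fun he =>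
    ((la.mem_SD _ _).1 (T.mem_SD_of_mem he)).2.1
  have hle' : ∀ {i j e}, e ∈ (T.primeMaxDiag I).entry (i, j) → i ≤ j := fun he =>
    ((la.mem_SD _ _).1 (SetTableau.mem_SD_of_mem _ he)).2.1
  refine ⟨?_, ?_, ?_, ?_⟩
  · intro i j d hd' e he
    have h1 := hle' hd'
    have he' := (key he).resolve_right fun h => by omega
    rcases key hd' with h | ⟨rfl, a, ha, rfl, -⟩
    · exact hT.row_le i j d h e he'
    · exact a.prime_le.trans (hT.row_le i i a ha e he')
  · intro i j d hd' e he
    have h1 := hle' he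
    have hd'' := (key hd').resolve_right fun h => by omega
    rcases key he with h | ⟨rfl, a, ha, rfl, -⟩
    · exact hT.col_le i j d hd'' e h
    · refine Entry.le_prime_of_lt (lt_of_le_of_ne (hT.col_le _ _ d hd'' a ha) ?_)
      rintro rfl
      have := hT.col_unprimed _ _ _ d (hd _ _ ha) hd'' ha
      omega
  · intro j i₁ i₂ e hp h1 h2
    have aux : ∀ {i}, e ∈ (T.primeMaxDiag I).entry (i, j) → e ∈ T.entry (i, j) := fun h =>
      (key h).resolve_right fun ⟨_, a, _, h, _⟩ => hp (h ▸ a.isPrimed_prime)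
    exact hT.col_unprimed j i₁ i₂ e hp (aux h1) (aux h2)
  · intro i j₁ j₂ e hp h1 h2
    have aux : ∀ {j a}, e = Entry.prime a → a ∈ T.entry (i, i) →
        e ∈ (T.primeMaxDiag I).entry (i, j) → i = j := by
      rintro j a rfl ha he
      rcases key he with h | h
      · by_contra hne
        have h3 := hle h
        have h4 := hT.row_le_of_lt (by omega) ha h
        exact Entry.prime_ne (hd _ _ ha) (le_antisymm a.prime_le h4)
      · exact h.1
    rcases key h1 with h1' | ⟨rfl, a, ha, he, -⟩
    · rcases key h2 with h2' | ⟨rfl, a, ha, he, -⟩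
      · exact hT.row_primed i j₁ j₂ e hp h1' h2'
      · exact (aux he ha h1).symm
    · exact aux he ha h2

/-- The rows `i ≤ ℓ(λ)` with `λ_i = μ_i`. -/
def equalRows (la mu : StrictPartition) : Finset ℕ :=
  (Finset.Icc 1 la.length).filter fun i => la.part i = mu.part i

theorem diag_mem_SD (la : StrictPartition) (i : ℕ) :
    (i, i) ∈ la.SD ↔ i ∈ Finset.Icc 1 la.length := by
  rw [StrictPartition.mem_SD, Finset.mem_Icc]
  refine and_congr_right fun h => ?_
  simp only [le_refl, true_and, StrictPartition.part, StrictPartition.length]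
  constructor
  · intro h1
    by_contra h2
    rw [List.getD_eq_default _ _ (by omega)] at h1
    omega
  · intro h1
    have h2 : i - 1 < la.parts.length := by omega
    rw [List.getD_eq_getElem _ _ h2]
    have := la.pos _ (List.getElem_mem h2)
    omega

theorem content_unprimeMax {X : Set (ℕ × ℕ)} (hX : ∀ b ∈ X, b.1 = b.2) {T : SetTableau la}
    (h : T.unprimeMax X ∈ SetShYTP la) : (T.unprimeMax X).content = T.content := by
  refine Finset.sum_congr rfl fun b _ => ?_
  have h2 := h.2 b.1
  simp only [SetTableau.unprimeMax] at h2 ⊢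
  split_ifs with hb
  · have e : (b.1, b.1) = b := Prod.ext rfl (hX b hb)
    rw [e, if_pos hb] at h2
    exact sum_unprimeMaxSet (fun k => Finsupp.single k 1) _ h2
  · rfl

theorem unprimeMax_primeMaxDiag {mu : StrictPartition} {T : SetTableau la}
    (hT : ∀ j, ∀ a ∈ T.entry (j, j), ¬ a.IsPrimed) {I : Finset ℕ} (hI : I ⊆ equalRows la mu) :
    (T.primeMaxDiag I).unprimeMax {b | ∃ i, 1 ≤ i ∧ la.part i = mu.part i ∧ b = (i, i)} = T := by
  refine SetTableau.ext (funext fun b => ?_)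
  simp only [SetTableau.unprimeMax, SetTableau.primeMaxDiag]
  split_ifs with h1 h2 h2
  · obtain ⟨i, -, -, rfl⟩ := h1
    exact unprimeMaxSet_primeMaxSet (hT i)
  · obtain ⟨i, -, -, rfl⟩ := h1
    exact unprimeMaxSet_of_unprimed (hT i)
  · have h3 := Finset.mem_filter.1 (hI h2.2)
    exact absurd ⟨b.1, (Finset.mem_Icc.1 h3.1).1, h3.2, Prod.ext rfl h2.1.symm⟩ h1
  · rfl

theorem unprimeMax_entry_of_not_primed {mu : StrictPartition} {T : SetTableau la} {b : ℕ × ℕ}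
    (h : ∀ a ∈ T.entry b, b.1 = b.2 → b.1 ∈ equalRows la mu → ¬ a.IsPrimed) :
    (T.unprimeMax {b | ∃ i, 1 ≤ i ∧ la.part i = mu.part i ∧ b = (i, i)}).entry b = T.entry b := by
  simp only [SetTableau.unprimeMax]
  split_ifs with h1
  · obtain ⟨i, -, hi, rfl⟩ := h1
    refine unprimeMaxSet_of_unprimed fun a ha => h a ha rfl ?_
    exact Finset.mem_filter.2 ⟨(diag_mem_SD la i).1 (T.mem_SD_of_mem ha), hi⟩
  · rfl

open Classical in
/-- A tableau in `SetShYT_P(λ : μ)` amounts to one in `SetShYT_P(λ)` and the set of those `i` with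
`λ_i = μ_i` whose diagonal box has a primed entry, which can be any set. -/
noncomputable def relEquiv (la mu : StrictPartition) :
    SetShYTPRel la mu ≃ SetShYTP la × (equalRows la mu).powerset where
  toFun T := ⟨⟨_, T.2.2⟩, ⟨(equalRows la mu).filter fun i => ∃ a ∈ T.1.entry (i, i), a.IsPrimed,
    Finset.mem_powerset.2 (Finset.filter_subset _ _)⟩⟩
  invFun P := ⟨P.1.1.primeMaxDiag P.2.1, P.1.2.1.primeMaxDiag P.1.2.2 _, by
    rw [unprimeMax_primeMaxDiag P.1.2.2 (Finset.mem_powerset.1 P.2.2)]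
    exact P.1.2⟩
  left_inv T := by
    refine Subtype.ext (SetTableau.ext (funext fun b => ?_))
    have h2 := T.2.2.2 b.1
    simp only [SetTableau.primeMaxDiag]
    split_ifs with h
    · obtain ⟨i, j⟩ := b
      obtain ⟨rfl : i = j, h⟩ := h
      have h3 := Finset.mem_filter.1 h
      have h4 := Finset.mem_filter.1 h3.1
      have hb : (i, i) ∈ {b : ℕ × ℕ | ∃ i, 1 ≤ i ∧ la.part i = mu.part i ∧ b = (i, i)} :=
        ⟨i, (Finset.mem_Icc.1 h4.1).1, h4.2, rfl⟩
      simp only [SetTableau.unprimeMax, if_pos hb] at h2 ⊢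
      exact primeMaxSet_unprimeMaxSet h3.2 h2
    · refine unprimeMax_entry_of_not_primed fun a ha hb hm hp => h ⟨hb, ?_⟩
      have e : (b.1, b.1) = b := Prod.ext rfl hb
      exact Finset.mem_filter.2 ⟨hm, a, by rwa [e], hp⟩
  right_inv P := by
    have hI := Finset.mem_powerset.1 P.2.2
    refine Prod.ext (Subtype.ext (unprimeMax_primeMaxDiag P.1.2.2 hI)) (Subtype.ext ?_)
    ext i
    rw [Finset.mem_filter]
    simp only [SetTableau.primeMaxDiag, true_and]
    constructor
    · rintro ⟨-, a, ha, hp⟩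
      by_contra hi
      rw [if_neg hi] at ha
      exact P.1.2.2 i a ha hp
    · intro hi
      rw [if_pos hi]
      refine ⟨hI hi, exists_isPrimed_primeMaxSet ((P.1.1.nonempty_iff _).2 ?_)⟩
      exact (diag_mem_SD la i).2 (Finset.mem_filter.1 (hI hi)).1

theorem card_rel (la mu : StrictPartition) (m : ℕ+ →₀ ℕ) :
    Nat.card {T : SetShYTPRel la mu // T.1.content = m}
      = 2 ^ (equalRows la mu).card * numP la m := by
  have e : {T : SetShYTPRel la mu // T.1.content = m} ≃
      {T : SetShYTP la // T.1.content = m} × (equalRows la mu).powerset :=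
    ((relEquiv la mu).subtypeEquiv (q := fun P => P.1.1.content = m) fun T => by
      rw [← content_unprimeMax (by rintro b ⟨i, -, -, rfl⟩; rfl) T.2.2]; rfl).trans
    (Equiv.prodSubtypeFstEquivSubtypeProd (p := fun P : SetShYTP la => P.1.content = m))
  rw [Nat.card_congr e, Nat.card_prod, numP, mul_comm,
    Nat.card_eq_fintype_card (α := Finset.powerset _), Fintype.card_coe, Finset.card_powerset]

end Priming

/-! ### The expansion and the bijection -/

section Bijection

open StrictPartition

theorem mem_partsOf (l : List Bool) (p : ℕ) : p + 1 ∈ partsOf l ↔ l[p]? = some true := by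
  induction l generalizing p with
  | nil => simp [partsOf]
  | cons a l ih =>
    have h0 : 0 ∉ partsOf l := fun h => lt_irrefl 0 ((ofBits l).pos 0 h)
    rcases p with _ | p
    · cases a <;> simp [partsOf, h0]
    · cases a <;> simp [partsOf, ih]

theorem ofBits_injOn (n : ℕ) : Set.InjOn ofBits (bitLists n : Set (List Bool)) := by
  intro l hl r hr h
  rw [Finset.mem_coe, mem_bitLists] at hl hr
  refine List.ext_getElem? fun p => ?_
  have h1 : l[p]? = some true ↔ r[p]? = some true := by
    rw [← mem_partsOf, ← mem_partsOf]
    exact iff_of_eq (congrArg (fun la : StrictPartition => p + 1 ∈ la.parts) h)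
  rcases Nat.lt_or_ge p n with hp | hp
  · rw [List.getElem?_eq_getElem (hl.symm ▸ hp), List.getElem?_eq_getElem (hr.symm ▸ hp)] at h1 ⊢
    simp only [Option.some.injEq] at h1 ⊢
    exact Bool.eq_iff_iff.2 h1
  · rw [List.getElem?_eq_none (by omega), List.getElem?_eq_none (by omega)]

theorem exists_ofBits_eq (la : StrictPartition) (n : ℕ) (h : ∀ p ∈ la.parts, p ≤ n) :
    ∃ l ∈ bitLists n, ofBits l = la := by
  refine ⟨(List.range n).map fun k => decide (k + 1 ∈ la.parts), by simp [mem_bitLists], ?_⟩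
  have hs : ∀ ka : StrictPartition, ka.parts.Nodup := fun ka => ka.strict.imp fun h => h.ne'
  refine StrictPartition.ext (List.Perm.eq_of_pairwise (le := (· > ·)) ?_ (ofBits _).strict
    la.strict ((List.perm_ext_iff_of_nodup (hs _) (hs _)).2 fun p => ?_))
  · intro a b _ _ h1 h2
    exact absurd (h1.trans h2) (lt_irrefl _)
  · rcases p with _ | p
    · exact iff_of_false (fun h0 => lt_irrefl 0 ((ofBits _).pos 0 h0)) fun h0 =>
        lt_irrefl 0 (la.pos 0 h0)
    · refine (mem_partsOf _ _).trans ?_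
      rw [List.getElem?_map]
      rcases Nat.lt_or_ge p n with hp | hp
      · simp [List.getElem?_range hp]
      · rw [List.getElem?_eq_none (by simpa using hp)]
        simp only [Option.map_none, reduceCtorEq, false_iff]
        exact fun h1 => by have := h _ h1; omega

theorem le_part_one (la : StrictPartition) {p : ℕ} (h : p ∈ la.parts) : p ≤ la.part 1 := by
  rcases la with ⟨_ | ⟨q, t⟩, hs, hp⟩
  · simp at h
  · change p ≤ q
    rcases List.mem_cons.1 h with rfl | h
    · exact le_rfl
    · exact ((List.pairwise_cons.1 hs).1 p h).le

theorem part_le_succ_of_mem_Lam {la mu : StrictPartition} (h : la ∈ Lam mu) {i : ℕ} (hi : 1 ≤ i) :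
    la.part i ≤ mu.part i + 1 := by
  by_contra hlt
  have hm : ∀ d, d < 2 → (i, i + mu.part i + d) ∈ skewSD la mu := fun d hd => by
    rw [skewSD, Finset.mem_sdiff, mem_SD, mem_SD]
    omega
  have := h.2.2 _ (hm 0 (by omega)) _ (hm 1 (by omega)) rfl
  simp at this

theorem skewSize_add_card_equalRows {la mu : StrictPartition} (h : la ∈ Lam mu) :
    skewSize la mu + (equalRows la mu).card = la.length := by
  have h1 : skewSize la mu
      = ((Finset.Icc 1 la.length).filter fun i => ¬ la.part i = mu.part i).card := by
    rw [skewSize, ← Finset.card_image_of_injOn (f := Prod.fst) fun b hb c hc e =>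
      h.2.2 b hb c hc e]
    congr 1
    ext i
    rw [Finset.mem_filter, ← diag_mem_SD, mem_SD]
    simp only [Finset.mem_image, Prod.exists, exists_and_right, exists_eq_right, skewSD,
      Finset.mem_sdiff, mem_SD]
    constructor
    · rintro ⟨j, h1, h2⟩
      omega
    · rintro ⟨h1, h2⟩
      have h3 := h.1 i h1.1
      exact ⟨i + mu.part i, by omega, by omega⟩
  rw [h1, equalRows, add_comm, Finset.card_filter_add_card_filter_not, Nat.card_Icc,
    Nat.add_sub_cancel]

open Classical in
theorem finite_Lam (mu : StrictPartition) : (Lam mu).Finite := by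
  refine ((bitLists (mu.part 1 + 1)).image ofBits).finite_toSet.subset fun la h => ?_
  obtain ⟨r, hr, rfl⟩ := exists_ofBits_eq la (mu.part 1 + 1) fun p hp =>
    (le_part_one la hp).trans (part_le_succ_of_mem_Lam h le_rfl)
  exact Finset.mem_coe.2 (Finset.mem_image_of_mem _ hr)

open Classical in
/-- The expansion `GQ_μ = ∑ ± 2^{#{i : λ_i = μ_i}} GP_λ`, coefficient by coefficient. -/
theorem numQ_eq_sum (mu : StrictPartition) (m : ℕ+ →₀ ℕ) :
    (numQ mu m : ℤ) = ∑ la ∈ (finite_Lam mu).toFinset, (-1 : ℤ) ^ (cols la mu + skewSize la mu)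
      * (2 ^ (equalRows la mu).card * numP la m : ℕ) := by
  obtain ⟨l₀, hl₀, hmu⟩ := exists_ofBits_eq mu (mu.part 1) fun p => le_part_one mu
  rw [mem_bitLists] at hl₀
  -- the further bit makes room for partitions whose largest part is greater by one
  set l := l₀ ++ [false] with hl
  have hlen : l.length = mu.part 1 + 1 := by simp [hl, hl₀]
  have hlmu : ofBits l = mu := by
    rw [← hmu]
    refine StrictPartition.ext ?_
    change partsOf l = partsOf l₀
    rw [hl]
    clear * -
    induction l₀ with
    | nil => rfl
    | cons a l ih => simp [partsOf, ih]
  have key := numQ_eq_expand m l (by simp [hl]) (by simp [hl])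
  rw [hlmu, expand_eq_sum, hlen] at key
  have himage : (finite_Lam mu).toFinset
      = ((bitLists (mu.part 1 + 1)).filter fun r => coef false l r ≠ 0).image ofBits := by
    ext la
    rw [Set.Finite.mem_toFinset, Finset.mem_image]
    constructor
    · intro h
      obtain ⟨r, hr, rfl⟩ := exists_ofBits_eq la (mu.part 1 + 1) fun p hp =>
        (le_part_one la hp).trans (part_le_succ_of_mem_Lam h le_rfl)
      refine ⟨r, Finset.mem_filter.2 ⟨hr, ?_⟩, rfl⟩
      rw [coef_ne_zero_iff _ _ _ (((mem_bitLists _ _).1 hr).trans hlen.symm),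
        ← ofBits_mem_Lam_iff, hlmu]
      exact h
    · rintro ⟨r, hr, rfl⟩
      obtain ⟨hr, hc⟩ := Finset.mem_filter.1 hr
      rwa [coef_ne_zero_iff _ _ _ (((mem_bitLists _ _).1 hr).trans hlen.symm),
        ← ofBits_mem_Lam_iff, hlmu] at hc
  rw [key, himage, Finset.sum_image fun r hr s hs e => ofBits_injOn _
    (Finset.mem_coe.2 (Finset.mem_filter.1 hr).1) (Finset.mem_coe.2 (Finset.mem_filter.1 hs).1) e,
    Finset.sum_filter]
  refine Finset.sum_congr rfl fun r hr => ?_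
  have hr' : r.length = l.length := ((mem_bitLists _ _).1 hr).trans hlen.symm
  split_ifs with hc
  · have hL : ofBits r ∈ Lam mu := by
      rwa [coef_ne_zero_iff _ _ _ hr', ← ofBits_mem_Lam_iff, hlmu] at hc
    have h1 := skewSize_add_card_equalRows hL
    rw [length_ofBits] at h1
    rw [(coef_eq false l r hr' hc).1, hlmu, ← h1, Nat.add_sub_cancel_left]
    push_cast
    ring
  · rw [not_not.1 hc, zero_mul]

/-- Two types with a statistic each, whose fibres are finite and of equal size, are in bijection by
a map that preserves the statistic. -/
theorem exists_equiv_of_card_fiber_eq {α β ι : Type*} (f : α → ι) (g : β → ι)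
    (hf : ∀ i, Finite {a // f a = i}) (hg : ∀ i, Finite {b // g b = i})
    (h : ∀ i, Nat.card {a // f a = i} = Nat.card {b // g b = i}) :
    ∃ e : α ≃ β, ∀ a, g (e a) = f a := by
  have e : ∀ i, Nonempty ({a // f a = i} ≃ {b // g b = i}) := fun i => by
    have := hf i
    have := hg i
    exact (Finite.card_eq (α := {a // f a = i})).1 (h i)
  refine ⟨(Equiv.sigmaFiberEquiv f).symm.trans ((Equiv.sigmaCongrRight fun i => (e i).some).trans
    (Equiv.sigmaFiberEquiv g)), fun a => ?_⟩
  exact ((e (f a)).some ⟨a, rfl⟩).2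

/-- A subtype of a sigma type is the sigma type of the subtypes. -/
def subtypeSigma {ι : Type*} {β : ι → Type*} (p : (i : ι) → β i → Prop) :
    {x : Σ i, β i // p x.1 x.2} ≃ Σ i, {b : β i // p i b} where
  toFun x := ⟨x.1.1, x.1.2, x.2⟩
  invFun x := ⟨⟨x.1, x.2.1⟩, x.2.2⟩
  left_inv _ := rfl
  right_inv _ := rfl

theorem finite_contentRel (la mu : StrictPartition) (m : ℕ+ →₀ ℕ) :
    Finite {T : SetShYTPRel la mu // T.1.content = m} := by
  have := finite_contentQ la m
  exact Finite.of_injective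
    (β := {T : SetShYTQ la // T.1.content = m}) (fun T => ⟨⟨T.1.1, T.1.2.1⟩, T.2⟩) fun T T' h =>
      Subtype.ext (Subtype.ext (congrArg (fun S => S.1.1) h))

theorem card_sigma_Lam {mu : StrictPartition} (S : Set StrictPartition) (hS : S ⊆ Lam mu)
    (m : ℕ+ →₀ ℕ) :
    Finite {x : Σ la : S, SetShYTPRel la.1 mu // x.2.1.content = m} ∧
    Nat.card {x : Σ la : S, SetShYTPRel la.1 mu // x.2.1.content = m} =
      ∑ la ∈ ((finite_Lam mu).subset hS).toFinset, 2 ^ (equalRows la mu).card * numP la m := by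
  have := ((finite_Lam mu).subset hS).fintype
  have := fun la : S => finite_contentRel la.1 mu m
  have e := subtypeSigma (fun (la : S) (T : SetShYTPRel la.1 mu) => T.1.content = m)
  refine ⟨Finite.of_equiv _ e.symm, ?_⟩
  rw [Nat.card_congr e, Nat.card_sigma, Finset.sum_subtype (p := (· ∈ S)) _ (by simp)]
  exact Finset.sum_congr rfl fun la _ => card_rel la.1 mu m

theorem numQ_add_sum (mu : StrictPartition) (m : ℕ+ →₀ ℕ) :
    numQ mu m + ∑ la ∈ ((finite_Lam mu).subset (fun _ h => h.1 : LamMinus mu ⊆ Lam mu)).toFinset,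
        2 ^ (equalRows la mu).card * numP la m
      = ∑ la ∈ ((finite_Lam mu).subset (fun _ h => h.1 : LamPlus mu ⊆ Lam mu)).toFinset,
        2 ^ (equalRows la mu).card * numP la m := by
  classical
  have h := numQ_eq_sum mu m
  rw [← Finset.sum_filter_add_sum_filter_not _
    (fun la => (-1 : ℤ) ^ (cols la mu + skewSize la mu) = 1)] at h
  have hP : (finite_Lam mu).toFinset.filter
      (fun la => (-1 : ℤ) ^ (cols la mu + skewSize la mu) = 1)
      = ((finite_Lam mu).subset (fun _ h => h.1 : LamPlus mu ⊆ Lam mu)).toFinset := by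
    ext la
    simp [LamPlus]
  have hM : (finite_Lam mu).toFinset.filter
      (fun la => ¬ (-1 : ℤ) ^ (cols la mu + skewSize la mu) = 1)
      = ((finite_Lam mu).subset (fun _ h => h.1 : LamMinus mu ⊆ Lam mu)).toFinset := by
    ext la
    simp only [Finset.mem_filter, Set.Finite.mem_toFinset, LamMinus, Set.mem_ofPred_eq]
    refine and_congr_right fun _ => ⟨fun h => (neg_one_pow_eq_or ℤ _).resolve_left h, fun h => ?_⟩
    rw [h]
    decide
  rw [hP, hM] at h
  rw [Finset.sum_congr rfl (g := fun la => ((2 ^ (equalRows la mu).card * numP la m : ℕ) : ℤ))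
    (fun la hla => by rw [((Set.Finite.mem_toFinset _).1 hla).2, one_mul]),
    Finset.sum_congr (s₁ := Set.Finite.toFinset (s := LamMinus mu) _) rfl
      (g := fun la => -((2 ^ (equalRows la mu).card * numP la m : ℕ) : ℤ))
    (fun la hla => by rw [((Set.Finite.mem_toFinset _).1 hla).2, neg_one_mul]),
    Finset.sum_neg_distrib, ← Nat.cast_sum, ← Nat.cast_sum] at h
  omega

end Bijection

end ShiftedTableaux

theorem mainTheorem9 (mu : ShiftedTableaux.StrictPartition) :
    ∃ f : (ShiftedTableaux.SetShYTQ mu ⊕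
            (Σ la : ShiftedTableaux.StrictPartition.LamMinus mu,
              ShiftedTableaux.SetShYTPRel la.1 mu)) ≃
          (Σ la : ShiftedTableaux.StrictPartition.LamPlus mu,
              ShiftedTableaux.SetShYTPRel la.1 mu),
      (∀ T : ShiftedTableaux.SetShYTQ mu,
        (f (Sum.inl T)).2.1.weight = T.1.weight) ∧
      (∀ (la : ShiftedTableaux.StrictPartition.LamMinus mu)
        (T : ShiftedTableaux.SetShYTPRel la.1 mu),
        (f (Sum.inr ⟨la, T⟩)).2.1.weight = T.1.weight) := by
  have hP := ShiftedTableaux.card_sigma_Lam (ShiftedTableaux.StrictPartition.LamPlus mu)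
    (fun _ h => h.1)
  have hM := ShiftedTableaux.card_sigma_Lam (ShiftedTableaux.StrictPartition.LamMinus mu)
    (fun _ h => h.1)
  let wt : (ShiftedTableaux.SetShYTQ mu ⊕
      (Σ la : ShiftedTableaux.StrictPartition.LamMinus mu,
      ShiftedTableaux.SetShYTPRel la.1 mu)) → ℕ+ →₀ ℕ :=
    Sum.elim (fun T => T.1.content) (fun x => x.2.1.content)
  have e := fun m => Equiv.subtypeSum (p := fun x => wt x = m)
  obtain ⟨f, hf⟩ := ShiftedTableaux.exists_equiv_of_card_fiber_eq wt
    (fun x : Σ la : ShiftedTableaux.StrictPartition.LamPlus mu,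
      ShiftedTableaux.SetShYTPRel la.1 mu => x.2.1.content)
    (fun m => by
      have h1 : Finite {T // wt (Sum.inl T) = m} := ShiftedTableaux.finite_contentQ mu m
      have h2 : Finite {T // wt (Sum.inr T) = m} := (hM m).1
      exact Finite.of_equiv _ (e m).symm)
    (fun m => (hP m).1)
    (fun m => by
      have h1 : Finite {T // wt (Sum.inl T) = m} := ShiftedTableaux.finite_contentQ mu m
      have h2 : Finite {T // wt (Sum.inr T) = m} := (hM m).1
      rw [Nat.card_congr (e m), Nat.card_sum]
      refine Eq.trans ?_ ((ShiftedTableaux.numQ_add_sum mu m).trans (hP m).2.symm)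
      exact congrArg₂ (· + ·) rfl (hM m).2)
  refine ⟨f, fun T => ?_, fun la T => ?_⟩
  · rw [ShiftedTableaux.weight_eq, ShiftedTableaux.weight_eq, hf]
    rfl
  · rw [ShiftedTableaux.weight_eq, ShiftedTableaux.weight_eq, hf]
    rfl
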